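/- Let $n\ge2$ and let $M=\{z\in\mathbb C^{n+1}:\ z\cdot z=0,\ z\neq0,\ |z|<1\}$ be the unit ball of the Kepler manifold, where $z\cdot w=\sum_j z_jw_j$; $M$ is an $n$-dimensional complex submanifold of $\mathbb C^{n+1}$. Let $u$ be a positive function on $M$ (radial or not) such that $\Phi=\log\frac1u$ is of class $C^2$ and strictly plurisubharmonic on $M$, and let $K$ be the reproducing kernel of the weighted Bergman space of all holomorphic functions on $M$ that are square-integrable with respect to $u^{n+1}\bigwedge^n\big(\frac i2\partial\bar\partial\log\frac1u\big)$, that is, in local holomorphic coordinates, with respect to $u^{n+1}\det\big[\partial^2\Phi/\partial z_j\partial\bar z_k\big]$ times Lebesgue measure. Assume that $u$ is balanced: there is a constant $c\neq0$ such that $$K(z,z)=\frac{c}{u(z)^{n+1}}\qquad\text{for all } z\in M.$$ Then the Kähler metric $g=\partial\bar\partial\log\frac1u$ on $M$, with coefficients $g_{j\bar k}=\partial^2\Phi/\partial z_j\partial\bar z_k$, is not complete at the origin: there is a sequence in $M$ that tends to $0$ in $\mathbb C^{n+1}$, is Cauchy for the distance induced by $g$, and has no limit in $M$ for this distance. Moreover,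 for every $z\in M$: (a) the radial segment $x\mapsto xz$, $0<x<1$, has finite length with respect to $g$; (b) there are an integer $m\ge0$ and a function $F$ holomorphic in a neighbourhood of $(0,0)$ in $\mathbb C^2$ such that $K(xz,xz)=|x|^{2m}e^{F(x,\bar x)}$ for all sufficiently small $x\in\mathbb C\setminus\{0\}$. -/

import Mathlib

open MeasureTheory Filter Topology
open scoped ENNReal ComplexConjugate

noncomputable section

namespace Kepler

/-- The unit ball `{z ∈ ℂⁿ⁺¹ : z · z = 0, z ≠ 0, |z| < 1}` of the Kepler manifold of dimension `n`
(bilinear dot product, Euclidean norm). -/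
def ball (n : ℕ) : Set (EuclideanSpace ℂ (Fin (n + 1))) :=
  {z | ∑ j, z j * z j = 0 ∧ z ≠ 0 ∧ ‖z‖ < 1}

/-- `φ : W → ball n` is (the inverse of) a holomorphic coordinate chart of the `n`-dimensional complex
submanifold `ball n`: an injective holomorphic immersion of an open set `W ⊆ ℂⁿ`.
Its values off `W` are irrelevant. -/
structure IsChart (n : ℕ) (W : Set (Fin n → ℂ))
    (φ : (Fin n → ℂ) → EuclideanSpace ℂ (Fin (n + 1))) : Prop where
  isOpen : IsOpen W
  mapsTo : Set.MapsTo φ W (ball n)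
  holo : DifferentiableOn ℂ φ W
  injOn : Set.InjOn φ W
  immersion : ∀ a ∈ W, Function.Injective (fderiv ℂ φ a)

/-- A function on `ball n` (its values elsewhere are irrelevant) is holomorphic if it is so in all
holomorphic charts. -/
def IsHolo (n : ℕ) (f : EuclideanSpace ℂ (Fin (n + 1)) → ℂ) : Prop :=
  ∀ W φ, IsChart n W φ → DifferentiableOn ℂ (f ∘ φ) W

/-- The Wirtinger derivative `∂f/∂z_j`. -/
def dz {n : ℕ} (j : Fin n) (f : (Fin n → ℂ) → ℂ) (a : Fin n → ℂ) : ℂ :=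
  (fderiv ℝ f a (Pi.single j 1) - Complex.I * fderiv ℝ f a (Pi.single j Complex.I)) / 2

/-- The Wirtinger derivative `∂f/∂z̄_j`. -/
def dzbar {n : ℕ} (j : Fin n) (f : (Fin n → ℂ) → ℂ) (a : Fin n → ℂ) : ℂ :=
  (fderiv ℝ f a (Pi.single j 1) + Complex.I * fderiv ℝ f a (Pi.single j Complex.I)) / 2

/-- The complex Hessian `∂²ψ/∂z_j∂z̄_k` of a real function `ψ` on `ℂⁿ`. -/
def complexHessian {n : ℕ} (ψ : (Fin n → ℂ) → ℝ) (a : Fin n → ℂ) : Matrix (Fin n) (Fin n) ℂ :=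
  Matrix.of fun j k => dz j (dzbar k fun b => (ψ b : ℂ)) a

/-- The Levi form `∑ (∂²ψ/∂z_j∂z̄_k) ξ_j ξ̄_k`. -/
def leviForm {n : ℕ} (ψ : (Fin n → ℂ) → ℝ) (a ξ : Fin n → ℂ) : ℝ :=
  (∑ j, ∑ k, complexHessian ψ a j k * ξ j * conj (ξ k)).re

/-- The local potential `Φ = log (1/u)` in the chart `φ`. -/
def potential {n : ℕ} (u : EuclideanSpace ℂ (Fin (n + 1)) → ℝ)
    (φ : (Fin n → ℂ) → EuclideanSpace ℂ (Fin (n + 1))) (a : Fin n → ℂ) : ℝ :=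
  Real.log (1 / u (φ a))

/-- `u` is a positive function on `ball n` such that `Φ = log (1/u)` is (twice continuously
differentiable and) strictly plurisubharmonic, so that `∂∂̄Φ` is a Kähler metric. -/
structure IsAdmissible (n : ℕ) (u : EuclideanSpace ℂ (Fin (n + 1)) → ℝ) : Prop where
  pos : ∀ z ∈ ball n, 0 < u z
  contDiff : ∀ W φ, IsChart n W φ → ContDiffOn ℝ 2 (potential u φ) W
  strictPsh : ∀ W φ, IsChart n W φ → ∀ a ∈ W, ∀ ξ : Fin n → ℂ, ξ ≠ 0 →
    0 < leviForm (potential u φ) a ξ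

/-- The measure `uⁿ⁺¹ ⋀ⁿ ((i/2) ∂∂̄ log (1/u))` on `ball n` (as a measure on `ℂⁿ⁺¹` carried by
`ball n`). In each chart it is `uⁿ⁺¹ det (∂²Φ/∂z_j∂z̄_k)` times Lebesgue measure
`(i/2)ⁿ dz₁∧dz̄₁∧…∧dz_n∧dz̄_n`; these local measures agree on overlaps,
and the global one is the least measure which dominates all of them. -/
def weightedVolume (n : ℕ) (u : EuclideanSpace ℂ (Fin (n + 1)) → ℝ) :
    Measure (EuclideanSpace ℂ (Fin (n + 1))) :=
  ⨆ (W : Set (Fin n → ℂ)) (φ : (Fin n → ℂ) → EuclideanSpace ℂ (Fin (n + 1)))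
    (_ : IsChart n W φ),
    Measure.map φ ((volume.restrict W).withDensity fun a =>
      ENNReal.ofReal (u (φ a) ^ (n + 1) * (complexHessian (potential u φ) a).det.re))

/-- Membership in the weighted Bergman space of all holomorphic functions on `ball n` that are
square integrable with respect to `uⁿ⁺¹ ⋀ⁿ ((i/2) ∂∂̄ log (1/u))`. -/
def MemBergman (n : ℕ) (u : EuclideanSpace ℂ (Fin (n + 1)) → ℝ)
    (f : EuclideanSpace ℂ (Fin (n + 1)) → ℂ) : Prop :=
  IsHolo n f ∧ MemLp f 2 (weightedVolume n u)

/-- `K` is (on `ball n × ball n`) the reproducing kernel of the weighted Bergman space. -/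
structure IsBergmanKernel (n : ℕ) (u : EuclideanSpace ℂ (Fin (n + 1)) → ℝ)
    (K : EuclideanSpace ℂ (Fin (n + 1)) → EuclideanSpace ℂ (Fin (n + 1)) → ℂ) : Prop where
  mem : ∀ x ∈ ball n, MemBergman n u fun y => K y x
  reproducing : ∀ f, MemBergman n u f → ∀ x ∈ ball n,
    f x = ∫ y, f y * conj (K y x) ∂(weightedVolume n u)

/-- The length `(∑ g_{jk̄} ξ_j ξ̄_k)^{1/2}`, with `g = ∂∂̄ log (1/u)`, of the vector `v` tangent to
`ball n` at `p`, where `ξ` represents `v` in a chart around `p`. The value does not depend on the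
chart, so the infimum is over equal numbers (it is `∞` if `v` is not tangent to `ball n`). -/
def metricNorm (n : ℕ) (u : EuclideanSpace ℂ (Fin (n + 1)) → ℝ)
    (p v : EuclideanSpace ℂ (Fin (n + 1))) : ℝ≥0∞ :=
  ⨅ (W : Set (Fin n → ℂ)) (φ : (Fin n → ℂ) → EuclideanSpace ℂ (Fin (n + 1)))
    (_ : IsChart n W φ) (a : Fin n → ℂ) (_ : a ∈ W) (_ : φ a = p)
    (ξ : Fin n → ℂ) (_ : fderiv ℂ φ a ξ = v),
    ENNReal.ofReal (Real.sqrt (leviForm (potential u φ) a ξ))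

/-- The length, in the metric `∂∂̄ log (1/u)`, of a curve `γ : (0,1) → ball n`. -/
def curveLength (n : ℕ) (u : EuclideanSpace ℂ (Fin (n + 1)) → ℝ)
    (γ : ℝ → EuclideanSpace ℂ (Fin (n + 1))) : ℝ≥0∞ :=
  ∫⁻ t in Set.Ioo (0 : ℝ) 1, metricNorm n u (γ t) (deriv γ t)

/-- The distance on `ball n` induced by the metric `∂∂̄ log (1/u)`: the infimum of the lengths of
continuously differentiable curves in `ball n` from `p` to `q`. -/
def metricDist (n : ℕ) (u : EuclideanSpace ℂ (Fin (n + 1)) → ℝ)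
    (p q : EuclideanSpace ℂ (Fin (n + 1))) : ℝ≥0∞ :=
  ⨅ (γ : ℝ → EuclideanSpace ℂ (Fin (n + 1))) (_ : ContDiffOn ℝ 1 γ (Set.Icc 0 1))
    (_ : Set.MapsTo γ (Set.Icc 0 1) (ball n)) (_ : γ 0 = p) (_ : γ 1 = q), curveLength n u γ

/-- The metric `∂∂̄ log (1/u)` is not complete at the origin: some sequence in `ball n` which
tends to `0` in `ℂⁿ⁺¹` is Cauchy for the induced distance and has no limit in `ball n`. -/
def IncompleteAtOrigin (n : ℕ) (u : EuclideanSpace ℂ (Fin (n + 1)) → ℝ) : Prop :=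
  ∃ p : ℕ → EuclideanSpace ℂ (Fin (n + 1)), (∀ k, p k ∈ ball n) ∧
    Tendsto p atTop (𝓝 0) ∧
    (∀ ε : ℝ≥0∞, 0 < ε → ∃ N, ∀ k ≥ N, ∀ l ≥ N, metricDist n u (p k) (p l) < ε) ∧
    ∀ q ∈ ball n, ¬ Tendsto (fun k => metricDist n u (p k) q) atTop (𝓝 0)

end Kepler

end

noncomputable section

namespace Kepler

variable {n : ℕ}

/-! ### The Levi form in terms of real second derivatives -/

/-! The reproducing property gives a feature map `κ` into a Hilbert space with ⟨κ y, κ x⟩ = K(y, x).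
Balance then reads ‖κ z‖² = c / u(z)^(n+1), so Φ = log (1/u) equals (1/(n+1)) log ‖κ‖² up to a
constant, and the behaviour of g near the vertex is that of `κ`.

Along a line, y ↦ κ(ȳ z) is holomorphic off 0 (`differentiableAt_feature_map`) and bounded near 0
(`exists_bound_feature_map`). The bound is a Hartogs phenomenon, and it is where n ≥ 2 matters: a
quadratic map ℂ² → cone, vanishing only at 0 and sending (s, 0) to s² z, supplies discs through s² z
that avoid the vertex and whose boundaries stay in a fixed compact subset of the cone. The maximum
principle on these discs bounds ‖κ(s² z)‖.

Hence the singularity is removable and κ(ȳ z) = y^m g(y) with g(0) ≠ 0. Polarizing ‖g‖² and taking a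
logarithm gives (b). Moreover Φ(xz) is (2m/(n+1)) log |x| plus a C² function. The logarithm is
harmonic and the radial Levi form is a quarter of the Laplacian of x ↦ Φ(xz), so the metric is
bounded along the ray. This gives (a), and the points z/(k+1) form a Cauchy sequence. They have no
limit q, because g dominates a multiple of the Euclidean metric near q (`exists_pos_le_metricDist`).
-/

lemma complex_smul_eq (c : ℂ) (v : Fin n → ℂ) :
    c • v = c.re • v + c.im • (Complex.I • v) := by
  ext i
  simp only [Pi.smul_apply, Pi.add_apply, smul_eq_mul, Complex.real_smul]
  conv_lhs => rw [← Complex.re_add_im c]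
  ring

lemma I_smul_complex_smul_eq (c : ℂ) (v : Fin n → ℂ) :
    Complex.I • c • v = c.re • (Complex.I • v) - c.im • v := by
  ext i
  simp only [Pi.smul_apply, Pi.sub_apply, smul_eq_mul, Complex.real_smul]
  conv_lhs => rw [← Complex.re_add_im c]
  linear_combination (c.im : ℂ) * v i * Complex.I_sq

/-- The Hermitian form attached to a real bilinear form on `ℂⁿ`. -/
def hermitianForm (B : (Fin n → ℂ) →L[ℝ] (Fin n → ℂ) →L[ℝ] ℝ) :
    (Fin n → ℂ) →ₗ[ℂ] (Fin n → ℂ) →ₗ⋆[ℂ] ℂ :=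
  LinearMap.mk₂'ₛₗ (RingHom.id ℂ) (starRingEnd ℂ)
    (fun v w => ((B v w : ℂ) + Complex.I * B v (Complex.I • w)
      - Complex.I * B (Complex.I • v) w + B (Complex.I • v) (Complex.I • w)) / 4)
    (fun v₁ v₂ w => by simp only [smul_add, map_add, add_apply]; push_cast; ring)
    (fun c v w => by
      rw [I_smul_complex_smul_eq, complex_smul_eq]
      simp only [map_add, map_sub, map_smul, add_apply, sub_apply, smul_apply, smul_eq_mul,
        RingHom.id_apply]
      push_cast
      conv_rhs => rw [← Complex.re_add_im c]
      linear_combination (-(c.im : ℂ) * (B v (Complex.I • w) - B (Complex.I • v) w) / 4) *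
        Complex.I_sq)
    (fun v w₁ w₂ => by simp only [smul_add, map_add]; push_cast; ring)
    (fun c v w => by
      have hc : conj c = c.re - c.im * Complex.I := by
        apply Complex.ext <;> simp
      rw [I_smul_complex_smul_eq, complex_smul_eq]
      simp only [map_add, map_sub, map_smul, smul_eq_mul, hc]
      push_cast
      linear_combination ((c.im : ℂ) * (B v (Complex.I • w) - B (Complex.I • v) w) / 4) *
        Complex.I_sq)

lemma hermitianForm_apply (B : (Fin n → ℂ) →L[ℝ] (Fin n → ℂ) →L[ℝ] ℝ) (v w : Fin n → ℂ) :
    hermitianForm B v w = ((B v w : ℂ) + Complex.I * B v (Complex.I • w)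
      - Complex.I * B (Complex.I • v) w + B (Complex.I • v) (Complex.I • w)) / 4 := rfl

lemma hermitianForm_eq_sum (B : (Fin n → ℂ) →L[ℝ] (Fin n → ℂ) →L[ℝ] ℝ) (ξ : Fin n → ℂ) :
    hermitianForm B ξ ξ = ∑ j, ∑ k, hermitianForm B (Pi.single j 1) (Pi.single k 1) * ξ j *
      conj (ξ k) := by
  have h : ξ = ∑ j, ξ j • (Pi.single j 1 : Fin n → ℂ) := by
    simpa using (pi_eq_sum_univ' ξ)
  conv_lhs => rw [h]
  simp only [map_sum, LinearMap.sum_apply, map_smul, LinearMap.smul_apply, LinearMap.map_smulₛₗ,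
    smul_eq_mul, Finset.mul_sum]
  rw [Finset.sum_comm]
  refine Finset.sum_congr rfl fun j _ => Finset.sum_congr rfl fun k _ => ?_
  ring

lemma complexHessian_eq {ψ : (Fin n → ℂ) → ℝ} {a : Fin n → ℂ} (h : ContDiffAt ℝ 2 ψ a)
    (j k : Fin n) :
    complexHessian ψ a j k =
      hermitianForm (fderiv ℝ (fderiv ℝ ψ) a) (Pi.single j 1) (Pi.single k 1) := by
  have hI : ∀ i : Fin n, (Pi.single i Complex.I : Fin n → ℂ) = Complex.I • Pi.single i 1 := by
    intro i; rw [← Pi.single_smul]; simp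
  have hd : ∀ᶠ b in 𝓝 a, DifferentiableAt ℝ ψ b := by
    filter_upwards [h.eventually (by simp)] with b hb using hb.differentiableAt (by simp)
  have hB : HasFDerivAt (fderiv ℝ ψ) (fderiv ℝ (fderiv ℝ ψ) a) a :=
    ((h.fderiv_right (m := 1) (by norm_num)).differentiableAt (by simp)).hasFDerivAt
  have h1 : ∀ᶠ b in 𝓝 a, dzbar k (fun b => (ψ b : ℂ)) b =
      ((fderiv ℝ ψ b (Pi.single k 1) : ℂ) + Complex.I * (fderiv ℝ ψ b (Pi.single k Complex.I))) / 2
      := by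
    filter_upwards [hd] with b hb
    have : HasFDerivAt (fun b => (ψ b : ℂ)) (Complex.ofRealCLM ∘L fderiv ℝ ψ b) b :=
      Complex.ofRealCLM.hasFDerivAt.comp b hb.hasFDerivAt
    simp [dzbar, this.fderiv]
  have h2 : ∀ v, HasFDerivAt (fun b => (fderiv ℝ ψ b v : ℂ))
      (Complex.ofRealCLM ∘L (fderiv ℝ (fderiv ℝ ψ) a).flip v) a := fun v =>
    Complex.ofRealCLM.hasFDerivAt.comp a
      (((ContinuousLinearMap.apply ℝ ℝ v).hasFDerivAt).comp a hB)
  have h3 := ((h2 (Pi.single k 1)).add ((h2 (Pi.single k Complex.I)).const_mul Complex.I)).mul_const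
    ((2 : ℂ)⁻¹)
  have h4 := (h3.congr_of_eventuallyEq h1).fderiv
  simp only [complexHessian, Matrix.of_apply, dz, h4, hermitianForm_apply, hI]
  simp
  linear_combination (-(fderiv ℝ (fderiv ℝ ψ) a (Complex.I • Pi.single j 1)
    (Complex.I • Pi.single k 1) : ℂ) / 4) * Complex.I_sq

/-- The mixed terms of `hermitianForm` are `I` times real numbers, so they drop out of the real
part. -/
lemma leviForm_eq {ψ : (Fin n → ℂ) → ℝ} {a : Fin n → ℂ} (h : ContDiffAt ℝ 2 ψ a) (ξ : Fin n → ℂ) :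
    leviForm ψ a ξ = (fderiv ℝ (fderiv ℝ ψ) a ξ ξ +
      fderiv ℝ (fderiv ℝ ψ) a (Complex.I • ξ) (Complex.I • ξ)) / 4 := by
  simp only [leviForm, complexHessian_eq h]
  rw [← hermitianForm_eq_sum, hermitianForm_apply]
  simp

open Laplacian

/-- In direction w the second derivative of ψ ∘ c is Hess ψ (w c', w c') + dψ(w² c''). Summing over
w = 1 and w = I kills the c'' term, since 1 + I² = 0. Both the independence of charts and the radial
estimate thus become statements about Laplacians in one complex variable. -/
lemma laplacian_comp {ψ : (Fin n → ℂ) → ℝ} {c : ℂ → Fin n → ℂ} {x : ℂ} (hc : AnalyticAt ℂ c x)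
    (h : ContDiffAt ℝ 2 ψ (c x)) :
    Δ (fun y => ψ (c y)) x = 4 * leviForm ψ (c x) (deriv c x) := by
  have hd : ∀ᶠ b in 𝓝 (c x), DifferentiableAt ℝ ψ b := by
    filter_upwards [h.eventually (by simp)] with b hb using hb.differentiableAt (by simp)
  have hB : HasFDerivAt (fderiv ℝ ψ) (fderiv ℝ (fderiv ℝ ψ) (c x)) (c x) :=
    ((h.fderiv_right (m := 1) (by norm_num)).differentiableAt (by simp)).hasFDerivAt
  have hcR : ∀ y, AnalyticAt ℂ c y →
      HasFDerivAt c ((ContinuousLinearMap.toSpanSingleton ℂ (deriv c y)).restrictScalars ℝ) y :=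
    fun y hy => hy.differentiableAt.hasDerivAt.hasFDerivAt.restrictScalars ℝ
  have hcR' : HasFDerivAt (deriv c)
      ((ContinuousLinearMap.toSpanSingleton ℂ (deriv (deriv c) x)).restrictScalars ℝ) x :=
    hc.deriv.differentiableAt.hasDerivAt.hasFDerivAt.restrictScalars ℝ
  have key : ∀ w : ℂ, HasFDerivAt (fun y => fderiv ℝ ψ (c y) (w • deriv c y))
      ((fderiv ℝ ψ (c x) ∘L (w • ((ContinuousLinearMap.toSpanSingleton ℂ
        (deriv (deriv c) x)).restrictScalars ℝ))) + ((fderiv ℝ (fderiv ℝ ψ) (c x) ∘L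
          ((ContinuousLinearMap.toSpanSingleton ℂ (deriv c x)).restrictScalars ℝ)).flip
            (w • deriv c x))) x := fun w =>
    (hB.comp x (hcR x hc)).clm_apply (hcR'.const_smul w)
  have hev : ∀ w : ℂ, ∀ᶠ y in 𝓝 x, fderiv ℝ (fun y => ψ (c y)) y w =
      fderiv ℝ ψ (c y) (w • deriv c y) := by
    intro w
    filter_upwards [hc.continuousAt.eventually hd, hc.eventually_analyticAt] with y hy hcy
    have := (hy.hasFDerivAt.comp y (hcR y hcy)).fderiv
    rw [show (fun y => ψ (c y)) = ψ ∘ c from rfl, this]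
    simp
  have hC : ContDiffAt ℝ 2 (fun y => ψ (c y)) x :=
    h.comp x ((hc.restrictScalars (𝕜 := ℝ)).contDiffAt)
  have hD : DifferentiableAt ℝ (fderiv ℝ (fun y => ψ (c y))) x :=
    (hC.fderiv_right (m := 1) (by norm_num)).differentiableAt (by simp)
  have h2 : ∀ w : ℂ, fderiv ℝ (fderiv ℝ (fun y => ψ (c y))) x w w =
      fderiv ℝ (fderiv ℝ ψ) (c x) (w • deriv c x) (w • deriv c x) +
        fderiv ℝ ψ (c x) ((w * w) • deriv (deriv c) x) := by
    intro w
    have h3 : fderiv ℝ (fun y => fderiv ℝ (fun y => ψ (c y)) y w) x w =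
        fderiv ℝ (fderiv ℝ (fun y => ψ (c y))) x w w := by
      have := (((ContinuousLinearMap.apply ℝ ℝ w).hasFDerivAt).comp x hD.hasFDerivAt).fderiv
      exact congrArg (fun L => L w) this
    rw [← h3, EventuallyEq.fderiv_eq (hev w), (key w).fderiv]
    simp [smul_smul, add_comm]
  rw [InnerProductSpace.laplacian_eq_iteratedFDeriv_complexPlane, leviForm_eq h]
  simp only [iteratedFDeriv_two_apply, Matrix.cons_val_zero, Matrix.cons_val_one, h2]
  simp
  ring

lemma continuousOn_leviForm {ψ : (Fin n → ℂ) → ℝ} {W : Set (Fin n → ℂ)} (hW : IsOpen W)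
    (h : ContDiffOn ℝ 2 ψ W) :
    ContinuousOn (fun p : (Fin n → ℂ) × (Fin n → ℂ) => leviForm ψ p.1 p.2) (W ×ˢ Set.univ) := by
  have hB : ContinuousOn (fderiv ℝ (fderiv ℝ ψ)) W := by
    have h1 : ContDiffOn ℝ 1 (fderiv ℝ ψ) W := h.fderiv_of_isOpen hW (by norm_num)
    exact h1.continuousOn_fderiv_of_isOpen hW le_rfl
  have hB' : ContinuousOn (fun p : (Fin n → ℂ) × (Fin n → ℂ) => fderiv ℝ (fderiv ℝ ψ) p.1)
      (W ×ˢ Set.univ) := hB.comp continuousOn_fst fun p hp => hp.1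
  refine ContinuousOn.congr (f := fun p : (Fin n → ℂ) × (Fin n → ℂ) =>
    (fderiv ℝ (fderiv ℝ ψ) p.1 p.2 p.2 +
      fderiv ℝ (fderiv ℝ ψ) p.1 (Complex.I • p.2) (Complex.I • p.2)) / 4) ?_ ?_
  · fun_prop
  · exact fun p hp => leviForm_eq (h.contDiffAt (hW.mem_nhds hp.1)) p.2

lemma leviForm_real_smul (ψ : (Fin n → ℂ) → ℝ) (a ξ : Fin n → ℂ) (t : ℝ) :
    leviForm ψ a (t • ξ) = t ^ 2 * leviForm ψ a ξ := by
  simp only [leviForm]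
  rw [← Complex.re_ofReal_mul]
  congr 1
  simp only [Finset.mul_sum]
  refine Finset.sum_congr rfl fun j _ => Finset.sum_congr rfl fun k _ => ?_
  simp
  ring

/-! ### Graph charts of the quadric cone -/

/-- Forget the `j`-th coordinate. -/
def dropCoord (j : Fin (n + 1)) : EuclideanSpace ℂ (Fin (n + 1)) →L[ℂ] (Fin n → ℂ) :=
  ContinuousLinearMap.pi fun i => EuclideanSpace.proj (j.succAbove i)

@[simp] lemma dropCoord_apply (j : Fin (n + 1)) (z : EuclideanSpace ℂ (Fin (n + 1))) (i : Fin n) :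
    dropCoord j z i = z (j.succAbove i) := rfl

/-- The square of the `j`-th coordinate on the quadric as a function of the other coordinates,
divided by the square of `c`. -/
def coordQuot (c : ℂ) (a : Fin n → ℂ) : ℂ := -(∑ i, a i * a i) / c ^ 2

/-- The quadric as a graph over the coordinates other than the `j`-th, with the branch of the
square root given by `c`. -/
def graphMap (c : ℂ) (j : Fin (n + 1)) (a : Fin n → ℂ) : EuclideanSpace ℂ (Fin (n + 1)) :=
  WithLp.toLp 2 (j.insertNth (c * coordQuot c a ^ (2⁻¹ : ℂ)) a)

/-- The domain of the chart `graphMap c j` of `ball n`. -/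
def graphDomain (c : ℂ) (j : Fin (n + 1)) : Set (Fin n → ℂ) :=
  {a | coordQuot c a ∈ Complex.slitPlane ∧ ‖graphMap c j a‖ < 1}

@[simp] lemma graphMap_self (c : ℂ) (j : Fin (n + 1)) (a : Fin n → ℂ) :
    graphMap c j a j = c * coordQuot c a ^ (2⁻¹ : ℂ) := by
  simp [graphMap]

@[simp] lemma graphMap_succAbove (c : ℂ) (j : Fin (n + 1)) (a : Fin n → ℂ) (i : Fin n) :
    graphMap c j a (j.succAbove i) = a i := by
  simp [graphMap]

@[simp] lemma dropCoord_graphMap (c : ℂ) (j : Fin (n + 1)) (a : Fin n → ℂ) :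
    dropCoord j (graphMap c j a) = a := by
  ext i; simp

lemma continuous_coordQuot (c : ℂ) : Continuous (coordQuot c : (Fin n → ℂ) → ℂ) := by
  unfold coordQuot; fun_prop

lemma differentiableAt_graphMap (c : ℂ) (j : Fin (n + 1)) {a : Fin n → ℂ}
    (ha : coordQuot c a ∈ Complex.slitPlane) : DifferentiableAt ℂ (graphMap c j) a := by
  rw [differentiableAt_piLp]
  intro i
  have hq : DifferentiableAt ℂ (coordQuot c : (Fin n → ℂ) → ℂ) a := by
    unfold coordQuot; fun_prop
  refine Fin.succAboveCases j ?_ (fun i => ?_) i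
  · simp only [graphMap_self]
    exact (hq.cpow_const ha).const_mul c
  · simp only [graphMap_succAbove]
    fun_prop

lemma isOpen_graphDomain (c : ℂ) (j : Fin (n + 1)) : IsOpen (graphDomain c j) := by
  have h1 : IsOpen {a : Fin n → ℂ | coordQuot c a ∈ Complex.slitPlane} :=
    Complex.isOpen_slitPlane.preimage (continuous_coordQuot c)
  have h2 : ContinuousOn (graphMap c j) {a : Fin n → ℂ | coordQuot c a ∈ Complex.slitPlane} :=
    fun a ha => (differentiableAt_graphMap c j ha).continuousAt.continuousWithinAt
  exact h2.norm.isOpen_inter_preimage h1 (isOpen_Iio (a := (1 : ℝ)))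

lemma graphMap_mem_ball {c : ℂ} (hc : c ≠ 0) {j : Fin (n + 1)} {a : Fin n → ℂ}
    (ha : a ∈ graphDomain c j) : graphMap c j a ∈ ball n := by
  have hne : coordQuot c a ^ (2⁻¹ : ℂ) ≠ 0 := by
    rw [Ne, Complex.cpow_eq_zero_iff]
    exact fun h => Complex.slitPlane_ne_zero ha.1 h.1
  refine ⟨?_, fun h => ?_, ha.2⟩
  · have hsq : (coordQuot c a ^ (2⁻¹ : ℂ)) ^ 2 = coordQuot c a := by
      simp
    rw [Fin.sum_univ_succAbove _ j]
    simp only [graphMap_self, graphMap_succAbove]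
    have : c * coordQuot c a ^ (2⁻¹ : ℂ) * (c * coordQuot c a ^ (2⁻¹ : ℂ)) =
      c ^ 2 * (coordQuot c a ^ (2⁻¹ : ℂ)) ^ 2 := by ring
    rw [this, hsq, coordQuot]
    field_simp
    ring
  · have : graphMap c j a j = 0 := by rw [h]; rfl
    rw [graphMap_self] at this
    exact (mul_ne_zero hc hne) this

lemma fderiv_graphMap_left_inverse {c : ℂ} {j : Fin (n + 1)} {a : Fin n → ℂ}
    (ha : coordQuot c a ∈ Complex.slitPlane) (ξ : Fin n → ℂ) :
    dropCoord j (fderiv ℂ (graphMap c j) a ξ) = ξ := by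
  have h1 := ((dropCoord j).hasFDerivAt.comp a (differentiableAt_graphMap c j ha).hasFDerivAt)
  have h2 : (dropCoord j ∘ graphMap c j) = id := by ext1 b; simp
  rw [h2] at h1
  exact congrArg (fun L => L ξ) (h1.unique (hasFDerivAt_id a))

lemma isChart_graphMap {c : ℂ} (hc : c ≠ 0) (j : Fin (n + 1)) :
    IsChart n (graphDomain c j) (graphMap c j) where
  isOpen := isOpen_graphDomain c j
  mapsTo := fun _ ha => graphMap_mem_ball hc ha
  holo := fun a ha => (differentiableAt_graphMap c j ha.1).differentiableWithinAt
  injOn := fun a _ b _ h => by simpa using congrArg (dropCoord j) h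
  immersion := fun a ha ξ η h => by
    simpa [fderiv_graphMap_left_inverse ha.1] using congrArg (dropCoord j) h

lemma coordQuot_dropCoord {c : ℂ} (j : Fin (n + 1)) {z : EuclideanSpace ℂ (Fin (n + 1))}
    (hz : ∑ i, z i * z i = 0) : coordQuot c (dropCoord j z) = (z j / c) ^ 2 := by
  rw [Fin.sum_univ_succAbove _ j] at hz
  simp only [coordQuot, dropCoord_apply]
  rw [← eq_neg_iff_add_eq_zero.mpr hz]
  ring

/-- The principal square root inverts squaring on the half-plane Re > 0, so `c` selects the sheet of
the cone. -/
lemma graphMap_dropCoord {c : ℂ} (hc : c ≠ 0) {j : Fin (n + 1)}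
    {z : EuclideanSpace ℂ (Fin (n + 1))} (hz : z ∈ ball n) (hre : 0 < (z j / c).re) :
    graphMap c j (dropCoord j z) = z := by
  ext i
  refine Fin.succAboveCases j ?_ (fun i => ?_) i
  · rw [graphMap_self, coordQuot_dropCoord j hz.1, Complex.sq_cpow_two_inv hre]
    field_simp
  · simp

lemma sq_mem_slitPlane {w : ℂ} (hw : 0 < w.re) : w ^ 2 ∈ Complex.slitPlane := by
  rw [Complex.mem_slitPlane_iff]
  by_cases h : w.im = 0
  · left; simp [pow_two, h]; positivity
  · right
    have : (w ^ 2).im = 2 * (w.re * w.im) := by simp [pow_two]; ring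
    rw [this]
    exact mul_ne_zero two_ne_zero (mul_ne_zero hw.ne' h)

lemma dropCoord_mem_graphDomain {c : ℂ} (hc : c ≠ 0) {j : Fin (n + 1)}
    {z : EuclideanSpace ℂ (Fin (n + 1))} (hz : z ∈ ball n) (hre : 0 < (z j / c).re) :
    dropCoord j z ∈ graphDomain c j :=
  ⟨by rw [coordQuot_dropCoord j hz.1]; exact sq_mem_slitPlane hre,
    by rw [graphMap_dropCoord hc hz hre]; exact hz.2.2⟩

/-- The principal root halves an argument in (-π, π). This is what prevents a curve from leaving the
sheet while its projection stays in the graph domain. -/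
lemma re_graphMap_div_pos {c : ℂ} (hc : c ≠ 0) {j : Fin (n + 1)} {a : Fin n → ℂ}
    (ha : a ∈ graphDomain c j) : 0 < (graphMap c j a j / c).re := by
  rw [graphMap_self, mul_div_cancel_left₀ _ hc,
    Complex.cpow_def_of_ne_zero (Complex.slitPlane_ne_zero ha.1), Complex.exp_re]
  refine mul_pos (Real.exp_pos _) (Real.cos_pos_of_mem_Ioo ?_)
  have h1 := Complex.arg_le_pi (coordQuot c a)
  have h2 := Complex.neg_pi_lt_arg (coordQuot c a)
  have h3 : (coordQuot c a).arg ≠ Real.pi := (Complex.mem_slitPlane_iff_arg.1 ha.1).1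
  have h4 : (Complex.log (coordQuot c a) * 2⁻¹).im = (coordQuot c a).arg / 2 := by
    simp [Complex.mul_im, Complex.log_im]; ring
  rw [h4]
  constructor
  · linarith
  · have := lt_of_le_of_ne h1 h3; linarith

lemma exists_coord_ne_zero {z : EuclideanSpace ℂ (Fin (n + 1))} (hz : z ∈ ball n) :
    ∃ j, z j ≠ 0 := by
  by_contra! h
  exact hz.2.1 (by ext i; simpa using h i)

lemma eventually_re_div_pos {z : EuclideanSpace ℂ (Fin (n + 1))} {j : Fin (n + 1)}
    (hj : z j ≠ 0) : ∀ᶠ w in 𝓝 z, 0 < (w j / z j).re := by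
  have hc : Continuous fun w : EuclideanSpace ℂ (Fin (n + 1)) => (w j / z j).re := by fun_prop
  refine hc.continuousAt.eventually (lt_mem_nhds ?_)
  simp [div_self hj]

/-- Holomorphic functions on the cone are holomorphic along holomorphic curves in the cone. -/
lemma IsHolo.differentiableAt_comp {f : EuclideanSpace ℂ (Fin (n + 1)) → ℂ} (hf : IsHolo n f)
    {γ : ℂ → EuclideanSpace ℂ (Fin (n + 1))} {x : ℂ} (hγ : DifferentiableAt ℂ γ x)
    (hmem : ∀ᶠ y in 𝓝 x, γ y ∈ ball n) : DifferentiableAt ℂ (fun y => f (γ y)) x := by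
  obtain ⟨j, hj⟩ := exists_coord_ne_zero hmem.self_of_nhds
  have hre := hγ.continuousAt.eventually (eventually_re_div_pos hj)
  have hdom : dropCoord j (γ x) ∈ graphDomain (γ x j) j :=
    dropCoord_mem_graphDomain hj hmem.self_of_nhds hre.self_of_nhds
  have h1 : DifferentiableAt ℂ (f ∘ graphMap (γ x j) j) (dropCoord j (γ x)) :=
    (hf _ _ (isChart_graphMap hj j)).differentiableAt ((isOpen_graphDomain _ _).mem_nhds hdom)
  have h2 : DifferentiableAt ℂ (fun y => (f ∘ graphMap (γ x j) j) (dropCoord j (γ y))) x :=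
    DifferentiableAt.comp (f := fun y => dropCoord j (γ y)) x h1
      (((dropCoord j).differentiableAt).comp x hγ)
  refine h2.congr_of_eventuallyEq ?_
  filter_upwards [hmem, hre] with y hy hy'
  simp [graphMap_dropCoord hj hy hy']

lemma IsAdmissible.continuousOn {u : EuclideanSpace ℂ (Fin (n + 1)) → ℝ} (hu : IsAdmissible n u) :
    ContinuousOn u (ball n) := by
  intro z hz
  obtain ⟨j, hj⟩ := exists_coord_ne_zero hz
  have hdom : dropCoord j z ∈ graphDomain (z j) j :=
    dropCoord_mem_graphDomain hj hz (by simp [div_self hj])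
  have h1 : ContinuousAt (potential u (graphMap (z j) j)) (dropCoord j z) :=
    ((hu.contDiff _ _ (isChart_graphMap hj j)).continuousOn).continuousAt
      ((isOpen_graphDomain _ _).mem_nhds hdom)
  have h2 : ContinuousAt (fun w => Real.exp (-potential u (graphMap (z j) j) (dropCoord j w))) z :=
    (Real.continuous_exp.continuousAt.comp
      (ContinuousAt.comp (f := dropCoord j) h1 (dropCoord j).continuous.continuousAt).neg)
  refine h2.continuousWithinAt.congr_of_eventuallyEq ?_ ?_
  · filter_upwards [self_mem_nhdsWithin, mem_nhdsWithin_of_mem_nhds (eventually_re_div_pos hj)]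
      with w hw hw'
    simp [potential, graphMap_dropCoord hj hw hw', Real.exp_log (hu.pos w hw)]
  · simp [potential, graphMap_dropCoord hj hz (by simp [div_self hj] : 0 < (z j / z j).re),
      Real.exp_log (hu.pos z hz)]

/-! ### Change of charts for the metric -/

/-- In an arbitrary chart, the Levi form of the potential is computed by a graph chart. -/
lemma leviForm_eq_graphMap {u : EuclideanSpace ℂ (Fin (n + 1)) → ℝ} (hu : IsAdmissible n u)
    {W : Set (Fin n → ℂ)} {φ : (Fin n → ℂ) → EuclideanSpace ℂ (Fin (n + 1))} (hφ : IsChart n W φ)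
    {a : Fin n → ℂ} (ha : a ∈ W) {c : ℂ} (hc : c ≠ 0) {j : Fin (n + 1)}
    (hre : 0 < (φ a j / c).re) (ξ : Fin n → ℂ) :
    leviForm (potential u φ) a ξ = leviForm (potential u (graphMap c j)) (dropCoord j (φ a))
      (dropCoord j (fderiv ℂ φ a ξ)) := by
  have hW : W ∈ 𝓝 a := hφ.isOpen.mem_nhds ha
  have hline : AnalyticAt ℂ (fun y : ℂ => a + y • ξ) 0 := by fun_prop
  have hd1 : HasDerivAt (fun y : ℂ => a + y • ξ) ξ 0 := by
    simpa using ((hasDerivAt_id (0 : ℂ)).smul_const ξ).const_add a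
  have h0 : a + (0 : ℂ) • ξ = a := by simp
  have hWev : ∀ᶠ y : ℂ in 𝓝 0, a + y • ξ ∈ W := by
    refine hline.continuousAt.eventually (p := (· ∈ W)) ?_
    have hW' : ∀ᶠ b in 𝓝 a, b ∈ W := hW
    simpa only [h0] using hW'
  have hφd : ∀ y : ℂ, a + y • ξ ∈ W → HasDerivAt (fun y : ℂ => φ (a + y • ξ))
      (fderiv ℂ φ (a + y • ξ) ξ) y := by
    intro y hy
    have h1 : HasDerivAt (fun y : ℂ => a + y • ξ) ξ y := by
      simpa using ((hasDerivAt_id y).smul_const ξ).const_add a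
    exact ((hφ.holo.differentiableAt (hφ.isOpen.mem_nhds hy)).hasFDerivAt).comp_hasDerivAt y h1
  have hcurve : AnalyticAt ℂ (fun y : ℂ => dropCoord j (φ (a + y • ξ))) 0 := by
    rw [Complex.analyticAt_iff_eventually_differentiableAt]
    filter_upwards [hWev] with y hy
    exact (dropCoord j).differentiableAt.comp y (hφd y hy).differentiableAt
  have hd2 : HasDerivAt (fun y : ℂ => dropCoord j (φ (a + y • ξ)))
      (dropCoord j (fderiv ℂ φ a ξ)) 0 := by
    have h := (dropCoord j).hasFDerivAt.comp_hasDerivAt 0 (hφd 0 (by rwa [h0]))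
    rw [h0] at h
    exact h
  have hdom := dropCoord_mem_graphDomain hc (hφ.mapsTo ha) hre
  have e1 := laplacian_comp (ψ := potential u φ) hline
    (by rw [h0]; exact (hu.contDiff W φ hφ).contDiffAt hW)
  have e2 := laplacian_comp (ψ := potential u (graphMap c j)) hcurve
    (by rw [h0]; exact (hu.contDiff _ _ (isChart_graphMap hc j)).contDiffAt
          ((isOpen_graphDomain _ _).mem_nhds hdom))
  rw [h0] at e1 e2
  rw [hd1.deriv] at e1
  rw [hd2.deriv] at e2
  have hev : (fun y : ℂ => potential u φ (a + y • ξ)) =ᶠ[𝓝 0]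
      fun y => potential u (graphMap c j) (dropCoord j (φ (a + y • ξ))) := by
    have hcont : ContinuousAt (fun y : ℂ => (φ (a + y • ξ) j / c).re) 0 := by
      have hcj : Continuous fun w : EuclideanSpace ℂ (Fin (n + 1)) => (w j / c).re := by fun_prop
      exact hcj.continuousAt.comp (hφd 0 (by rwa [h0])).continuousAt
    have hpos : ∀ᶠ y : ℂ in 𝓝 0, 0 < (φ (a + y • ξ) j / c).re := by
      refine hcont.eventually (lt_mem_nhds ?_)
      simpa only [h0] using hre
    filter_upwards [hWev, hpos] with y hy hy'
    simp [potential, graphMap_dropCoord hc (hφ.mapsTo hy) hy']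
  -- Both Levi forms are a quarter of the Laplacian at 0 of one and the same function of y.
  have e3 := (InnerProductSpace.laplacian_congr_nhds hev).self_of_nhds
  linarith

/-! ### Length estimates -/

lemma smul_mem_ball {z : EuclideanSpace ℂ (Fin (n + 1))} (hz : z ∈ ball n) {y : ℂ} (hy : y ≠ 0)
    (hy1 : ‖y‖ * ‖z‖ < 1) : y • z ∈ ball n := by
  refine ⟨?_, smul_ne_zero hy hz.2.1, by rwa [norm_smul]⟩
  have : ∀ j, (y • z) j * (y • z) j = y ^ 2 * (z j * z j) := fun j => by
    simp only [PiLp.smul_apply, smul_eq_mul]; ring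
  simp_rw [this, ← Finset.mul_sum, hz.1, mul_zero]

/-- The Levi form is continuous and positive on the compact set of pairs (point of `S`, unit
vector), hence bounded below there; real homogeneity extends the bound to all vectors. -/
lemma exists_pos_le_leviForm {ψ : (Fin n → ℂ) → ℝ} {W : Set (Fin n → ℂ)} (hW : IsOpen W)
    (h : ContDiffOn ℝ 2 ψ W) (hpos : ∀ a ∈ W, ∀ ξ : Fin n → ℂ, ξ ≠ 0 → 0 < leviForm ψ a ξ)
    {S : Set (Fin n → ℂ)} (hS : IsCompact S) (hSW : S ⊆ W) :
    ∃ ε : ℝ, 0 < ε ∧ ∀ a ∈ S, ∀ ξ, ε * ‖ξ‖ ≤ √(leviForm ψ a ξ) := by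
  have hc : ContinuousOn (fun p : (Fin n → ℂ) × (Fin n → ℂ) => leviForm ψ p.1 p.2)
      (S ×ˢ Metric.sphere 0 1) :=
    (continuousOn_leviForm hW h).mono fun p hp => ⟨hSW hp.1, trivial⟩
  obtain ⟨m, hm, hle⟩ := (hS.prod (isCompact_sphere 0 1)).exists_forall_le' hc (a := 0)
    fun p hp => hpos p.1 (hSW hp.1) p.2 (by
      intro h0
      have := hp.2
      simp [h0] at this)
  refine ⟨√m, Real.sqrt_pos.2 hm, fun a ha ξ => ?_⟩
  rcases eq_or_ne ξ 0 with rfl | hξ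
  · simp
  have hn : ‖ξ‖ ≠ 0 := norm_ne_zero_iff.2 hξ
  have h1 := hle (a, ‖ξ‖⁻¹ • ξ) ⟨ha, by simp [norm_smul, hn]⟩
  have h2 : leviForm ψ a ξ = ‖ξ‖ ^ 2 * leviForm ψ a (‖ξ‖⁻¹ • ξ) := by
    rw [← leviForm_real_smul, smul_smul, mul_inv_cancel₀ hn, one_smul]
  rw [h2, Real.sqrt_mul (by positivity), Real.sqrt_sq (norm_nonneg _), mul_comm]
  gcongr

/-- Points near the vertex of the cone have distance bounded below from a given point. -/
lemma exists_pos_le_metricDist {u : EuclideanSpace ℂ (Fin (n + 1)) → ℝ} (hu : IsAdmissible n u)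
    {q : EuclideanSpace ℂ (Fin (n + 1))} (hq : q ∈ ball n) :
    ∃ δ : ℝ≥0∞, 0 < δ ∧ ∀ᶠ p in 𝓝 0, δ ≤ metricDist n u p q := by
  obtain ⟨j, hj⟩ := exists_coord_ne_zero hq
  have hre : 0 < (q j / q j).re := by simp [div_self hj]
  have hchart := isChart_graphMap hj j
  set ψ := graphMap (q j) j with hψ
  set b := dropCoord j q with hb
  have hbW : b ∈ graphDomain (q j) j := dropCoord_mem_graphDomain hj hq hre
  -- The vertex projects to 0, so taking r < ‖b‖ keeps points near it outside `U`.
  have hb0 : b ≠ 0 := by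
    intro h
    have := coordQuot_dropCoord (c := q j) j hq.1
    rw [← hb, h] at this
    simp [coordQuot, div_self hj] at this
  obtain ⟨r₀, hr₀, hball⟩ := Metric.isOpen_iff.1 (isOpen_graphDomain (q j) j) b hbW
  obtain ⟨r, hr, hrr⟩ : ∃ r, 0 < r ∧ r < min r₀ ‖b‖ :=
    exists_between (lt_min hr₀ (norm_pos_iff.2 hb0))
  have hsub : Metric.closedBall b r ⊆ graphDomain (q j) j := fun x hx =>
    hball (lt_of_le_of_lt hx (hrr.trans_le (min_le_left _ _)))
  obtain ⟨ε, hε, hlevi⟩ := exists_pos_le_leviForm (isOpen_graphDomain (q j) j)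
    (hu.contDiff _ _ hchart) (hu.strictPsh _ _ hchart) (isCompact_closedBall b r) hsub
  let U : Set (EuclideanSpace ℂ (Fin (n + 1))) :=
    {w | 0 < (w j / q j).re} ∩ {w | ‖dropCoord j w - b‖ < r}
  have hU : IsOpen U := by
    refine IsOpen.inter (isOpen_lt continuous_const ?_) (isOpen_lt ?_ continuous_const)
    · fun_prop
    · fun_prop
  have hnorm : ∀ p ∈ U, ∀ v, ENNReal.ofReal ε * ‖dropCoord j v‖ₑ ≤ metricNorm n u p v := by
    intro p hp v
    refine le_iInf fun W => le_iInf fun φ => le_iInf fun hφ => le_iInf fun a => le_iInf fun ha =>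
      le_iInf fun hap => le_iInf fun ξ => le_iInf fun hξ => ?_
    rw [leviForm_eq_graphMap hu hφ ha hj (by rw [hap]; exact hp.1) ξ, hap, hξ,
      ← ofReal_norm, ← ENNReal.ofReal_mul hε.le]
    refine ENNReal.ofReal_le_ofReal (hlevi _ ?_ _)
    rw [mem_closedBall_iff_norm]
    exact hp.2.le
  refine ⟨ENNReal.ofReal ε * ENNReal.ofReal r, by simp [hε, hr], ?_⟩
  have hev : ∀ᶠ p in 𝓝 (0 : EuclideanSpace ℂ (Fin (n + 1))), r < ‖dropCoord j p - b‖ := by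
    have hc : Continuous fun p : EuclideanSpace ℂ (Fin (n + 1)) => ‖dropCoord j p - b‖ := by
      fun_prop
    refine hc.continuousAt.eventually (lt_mem_nhds ?_)
    simpa using hrr.trans_le (min_le_right _ _)
  filter_upwards [hev] with p hp
  refine le_iInf fun γ => le_iInf fun hγ => le_iInf fun hmaps => le_iInf fun h0 =>
    le_iInf fun h1 => ?_
  have hp0 : γ 0 ∉ U := fun h => by
    have := h.2
    rw [h0] at this
    exact lt_asymm hp this
  have hq1 : γ 1 ∈ U := by
    rw [h1]; exact ⟨hre, by simpa [hb] using hr⟩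
  have hclosed : IsClosed (Set.Icc (0 : ℝ) 1 ∩ γ ⁻¹' Uᶜ) :=
    hγ.continuousOn.preimage_isClosed_of_isClosed isClosed_Icc hU.isClosed_compl
  -- The last time at which the curve is outside `U`.
  obtain ⟨t₁, ht₁, hgr⟩ := (isCompact_Icc.of_isClosed_subset hclosed
    Set.inter_subset_left).exists_isGreatest ⟨0, ⟨by simp, hp0⟩⟩
  have ht₁1 : t₁ < 1 := lt_of_le_of_ne ht₁.1.2 fun h => ht₁.2 (by rw [h]; exact hq1)
  have hin : ∀ t, t₁ < t → t ≤ 1 → γ t ∈ U := fun t ht ht1 => by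
    by_contra hcon
    exact absurd (hgr ⟨⟨ht₁.1.1.trans ht.le, ht1⟩, hcon⟩) (not_le.2 ht)
  -- Otherwise `γ t₁` would violate only the sheet condition. But `γ` lies on the graph after `t₁`,
  -- so by continuity it does at `t₁` too, and points of the graph satisfy that condition.
  have hexit : r ≤ ‖dropCoord j (γ t₁) - b‖ := by
    by_contra! hlt
    have hmem : dropCoord j (γ t₁) ∈ graphDomain (q j) j :=
      hsub (by rw [mem_closedBall_iff_norm]; exact hlt.le)
    have hcγ : Tendsto γ (𝓝[Set.Ioc t₁ 1] t₁) (𝓝 (γ t₁)) :=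
      (hγ.continuousOn t₁ ht₁.1).mono_left (nhdsWithin_mono _ fun t ht =>
        ⟨ht₁.1.1.trans ht.1.le, ht.2⟩)
    have hcψ : Tendsto (fun t => ψ (dropCoord j (γ t))) (𝓝[Set.Ioc t₁ 1] t₁)
        (𝓝 (ψ (dropCoord j (γ t₁)))) :=
      (differentiableAt_graphMap (q j) j hmem.1).continuousAt.tendsto.comp
        ((dropCoord j).continuous.continuousAt.tendsto.comp hcγ)
    have hcγ' : Tendsto γ (𝓝[Set.Ioc t₁ 1] t₁) (𝓝 (ψ (dropCoord j (γ t₁)))) := by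
      refine hcψ.congr' ?_
      filter_upwards [self_mem_nhdsWithin] with t ht
      exact graphMap_dropCoord hj (hmaps ⟨ht₁.1.1.trans ht.1.le, ht.2⟩) (hin t ht.1 ht.2).1
    have : (𝓝[Set.Ioc t₁ 1] t₁).NeBot := left_nhdsWithin_Ioc_neBot ht₁1
    have heq := tendsto_nhds_unique hcγ hcγ'
    refine ht₁.2 ⟨?_, hlt⟩
    have := re_graphMap_div_pos hj hmem
    rwa [← hψ, ← heq] at this
  have hC1 : ContDiffOn ℝ 1 (fun t => dropCoord j (γ t)) (Set.Icc t₁ 1) :=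
    ((dropCoord j).restrictScalars ℝ).contDiff.comp_contDiffOn
      (hγ.mono (Set.Icc_subset_Icc_left ht₁.1.1))
  have hlen := enorm_sub_le_lintegral_deriv_of_contDiffOn_Icc hC1 ht₁1.le
  have hrle : ENNReal.ofReal r ≤ ‖dropCoord j (γ 1) - dropCoord j (γ t₁)‖ₑ := by
    rw [← ofReal_norm, h1, norm_sub_rev]
    exact ENNReal.ofReal_le_ofReal hexit
  calc ENNReal.ofReal ε * ENNReal.ofReal r
      ≤ ENNReal.ofReal ε * ∫⁻ t in Set.Icc t₁ 1, ‖deriv (fun t => dropCoord j (γ t)) t‖ₑ := by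
        gcongr; exact hrle.trans hlen
    _ = ENNReal.ofReal ε * ∫⁻ t in Set.Ioo t₁ 1, ‖deriv (fun t => dropCoord j (γ t)) t‖ₑ := by
        rw [restrict_Ioo_eq_restrict_Icc]
    _ ≤ ∫⁻ t in Set.Ioo t₁ 1, ENNReal.ofReal ε * ‖deriv (fun t => dropCoord j (γ t)) t‖ₑ :=
        lintegral_const_mul_le _ _
    _ ≤ ∫⁻ t in Set.Ioo t₁ 1, metricNorm n u (γ t) (deriv γ t) := by
        refine setLIntegral_mono' measurableSet_Ioo fun t ht => ?_
        have hd : HasDerivAt γ (deriv γ t) t :=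
          ((hγ.differentiableOn (by simp)).differentiableAt
            (Icc_mem_nhds (ht₁.1.1.trans_lt ht.1) ht.2)).hasDerivAt
        have hd' : deriv (fun t => dropCoord j (γ t)) t = dropCoord j (deriv γ t) :=
          (((dropCoord j).restrictScalars ℝ).hasFDerivAt.comp_hasDerivAt t hd).deriv
        rw [hd']
        exact hnorm _ (hin t ht.1 ht.2.le) _
    _ ≤ curveLength n u γ :=
        lintegral_mono_set (Set.Ioo_subset_Ioo_left ht₁.1.1)

lemma graphMap_smul {z : EuclideanSpace ℂ (Fin (n + 1))} (hz : z ∈ ball n) {j : Fin (n + 1)}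
    (hj : z j ≠ 0) {y : ℂ} (hy : 0 < y.re) (hy1 : ‖y‖ * ‖z‖ < 1) :
    graphMap (z j) j (y • dropCoord j z) = y • z := by
  rw [← map_smul]
  refine graphMap_dropCoord hj (smul_mem_ball hz (by rintro rfl; simp at hy) hy1) ?_
  simpa [mul_div_cancel_right₀ _ hj] using hy

lemma smul_dropCoord_mem {z : EuclideanSpace ℂ (Fin (n + 1))} (hz : z ∈ ball n) {j : Fin (n + 1)}
    (hj : z j ≠ 0) {y : ℂ} (hy : 0 < y.re) (hy1 : ‖y‖ * ‖z‖ < 1) :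
    y • dropCoord j z ∈ graphDomain (z j) j := by
  rw [← map_smul]
  refine dropCoord_mem_graphDomain hj (smul_mem_ball hz (by rintro rfl; simp at hy) hy1) ?_
  simpa [mul_div_cancel_right₀ _ hj] using hy

lemma eventually_re_pos_and_norm_lt {z : EuclideanSpace ℂ (Fin (n + 1))} {y : ℂ} (hy : 0 < y.re)
    (hy1 : ‖y‖ * ‖z‖ < 1) : ∀ᶠ w in 𝓝 y, 0 < w.re ∧ ‖w‖ * ‖z‖ < 1 :=
  (Complex.continuous_re.continuousAt.eventually (lt_mem_nhds hy)).and
    ((show Continuous fun w : ℂ => ‖w‖ * ‖z‖ by fun_prop).continuousAt.eventually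
      (gt_mem_nhds hy1))

/-- The Levi form in the radial direction. -/
lemma four_mul_leviForm_radial {u : EuclideanSpace ℂ (Fin (n + 1)) → ℝ} (hu : IsAdmissible n u)
    {z : EuclideanSpace ℂ (Fin (n + 1))} (hz : z ∈ ball n) {j : Fin (n + 1)}
    (hj : z j ≠ 0) {y : ℂ} (hy : 0 < y.re) (hy1 : ‖y‖ * ‖z‖ < 1) :
    4 * leviForm (potential u (graphMap (z j) j)) (y • dropCoord j z) (dropCoord j z) =
      Δ (fun w : ℂ => -Real.log (u (w • z))) y := by
  have hline : AnalyticAt ℂ (fun w : ℂ => w • dropCoord j z) y := by fun_prop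
  have hd : HasDerivAt (fun w : ℂ => w • dropCoord j z) (dropCoord j z) y := by
    simpa using (hasDerivAt_id y).smul_const (dropCoord j z)
  have e := laplacian_comp (ψ := potential u (graphMap (z j) j)) hline
    ((hu.contDiff _ _ (isChart_graphMap hj j)).contDiffAt
      ((isOpen_graphDomain _ _).mem_nhds (smul_dropCoord_mem hz hj hy hy1)))
  rw [hd.deriv] at e
  rw [← e]
  refine (InnerProductSpace.laplacian_congr_nhds ?_).self_of_nhds
  filter_upwards [eventually_re_pos_and_norm_lt hy hy1] with w hw
  simp [potential, graphMap_smul hz hj hw.1 hw.2]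

/-- For an upper bound a single competitor in the infimum suffices: the graph chart, in which the
ray is a straight ray. -/
lemma metricNorm_radial_le (u : EuclideanSpace ℂ (Fin (n + 1)) → ℝ)
    {z : EuclideanSpace ℂ (Fin (n + 1))} (hz : z ∈ ball n) {j : Fin (n + 1)}
    (hj : z j ≠ 0) {t : ℝ} (ht : 0 < t) (ht1 : t * ‖z‖ < 1) (s : ℝ) :
    metricNorm n u (t • z) (s • z) ≤ ENNReal.ofReal (|s| *
      √(leviForm (potential u (graphMap (z j) j)) ((t : ℂ) • dropCoord j z) (dropCoord j z))) := by
  have ht' : 0 < (t : ℂ).re := by simpa using ht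
  have ht1' : ‖(t : ℂ)‖ * ‖z‖ < 1 := by simpa [abs_of_pos ht] using ht1
  have hmem := smul_dropCoord_mem hz hj ht' ht1'
  have hval : graphMap (z j) j ((t : ℂ) • dropCoord j z) = t • z :=
    graphMap_smul hz hj ht' ht1'
  have hder : fderiv ℂ (graphMap (z j) j) ((t : ℂ) • dropCoord j z) (dropCoord j z) = z := by
    have hd : HasDerivAt (fun w : ℂ => w • dropCoord j z) (dropCoord j z) (t : ℂ) := by
      simpa using (hasDerivAt_id (t : ℂ)).smul_const (dropCoord j z)
    have h1 := (differentiableAt_graphMap (z j) j hmem.1).hasFDerivAt.comp_hasDerivAt _ hd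
    have h2 : HasDerivAt (fun w : ℂ => w • z) z (t : ℂ) := by
      simpa using (hasDerivAt_id (t : ℂ)).smul_const z
    refine h1.unique (h2.congr_of_eventuallyEq ?_)
    filter_upwards [eventually_re_pos_and_norm_lt ht' ht1'] with w hw
    exact graphMap_smul hz hj hw.1 hw.2
  have hξ : fderiv ℂ (graphMap (z j) j) ((t : ℂ) • dropCoord j z) (s • dropCoord j z) = s • z := by
    have : s • dropCoord j z = (s : ℂ) • dropCoord j z := rfl
    rw [this, map_smul, hder]
    rfl
  have hval' : √(leviForm (potential u (graphMap (z j) j)) ((t : ℂ) • dropCoord j z)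
      (s • dropCoord j z)) = |s| *
      √(leviForm (potential u (graphMap (z j) j)) ((t : ℂ) • dropCoord j z) (dropCoord j z)) := by
    rw [leviForm_real_smul, Real.sqrt_mul (by positivity), Real.sqrt_sq_eq_abs]
  rw [← hval']
  exact iInf₂_le_of_le _ _ <| iInf₂_le_of_le (isChart_graphMap hj j) _ <|
    iInf₂_le_of_le hmem hval <| iInf₂_le_of_le _ hξ le_rfl

/-! ### Hilbert space valued holomorphic functions -/

section HilbertValued

variable {H : Type*} [NormedAddCommGroup H] [InnerProductSpace ℂ H]

/-- A locally bounded map to a Hilbert space whose inner products with its own values are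
holomorphic is continuous. -/
lemma continuousAt_of_differentiableOn_inner {U : Set ℂ} (hU : IsOpen U) {G : ℂ → H}
    (hG : ∀ x ∈ U, DifferentiableOn ℂ (fun y => inner ℂ (G x) (G y)) U)
    {x₀ : ℂ} (hx₀ : x₀ ∈ U) {C : ℝ} (hb : ∀ᶠ y in 𝓝 x₀, ‖G y‖ ≤ C) : ContinuousAt G x₀ := by
  obtain ⟨ρ, hρ, hball⟩ := Metric.eventually_nhds_iff_ball.1 (hb.and (hU.mem_nhds hx₀))
  -- The Schwarz lemma gives a Lipschitz bound uniform in `w`, which allows `w = y` below.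
  have hlip : ∀ w ∈ Metric.ball x₀ ρ, ∀ y ∈ Metric.ball x₀ ρ,
      ‖inner ℂ (G w) (G y) - inner ℂ (G w) (G x₀)‖ ≤ (2 * C ^ 2) / ρ * dist y x₀ := by
    intro w hw y hy
    have hle : ∀ y ∈ Metric.ball x₀ ρ, ‖inner ℂ (G w) (G y)‖ ≤ C ^ 2 := fun y hy =>
      (norm_inner_le_norm _ _).trans (by
        rw [pow_two]
        exact mul_le_mul (hball w hw).1 (hball y hy).1 (norm_nonneg _)
          ((norm_nonneg _).trans (hball w hw).1))
    have := Complex.dist_le_div_mul_dist_of_mapsTo_ball (f := fun y => inner ℂ (G w) (G y))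
      (c := x₀) (R₁ := ρ) (R₂ := 2 * C ^ 2)
      ((hG w (hball w hw).2).mono fun y hy => (hball y hy).2)
      (fun y hy => by
        rw [mem_closedBall_iff_norm]
        have h1 := hle y hy
        have h2 := hle x₀ (Metric.mem_ball_self hρ)
        exact (norm_sub_le _ _).trans (by linarith)) hy
    rwa [dist_eq_norm] at this
  have hsq : ∀ y ∈ Metric.ball x₀ ρ, ‖G y - G x₀‖ ^ 2 ≤ (4 * C ^ 2) / ρ * dist y x₀ := by
    intro y hy
    have h1 := hlip y hy y hy
    have h2 := hlip x₀ (Metric.mem_ball_self hρ) y hy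
    have h3 : ((‖G y - G x₀‖ ^ 2 : ℝ) : ℂ) = (inner ℂ (G y) (G y) - inner ℂ (G y) (G x₀)) -
        (inner ℂ (G x₀) (G y) - inner ℂ (G x₀) (G x₀)) := by
      have := inner_self_eq_norm_sq_to_K (𝕜 := ℂ) (G y - G x₀)
      rw [inner_sub_sub_self] at this
      rw [Complex.ofReal_pow]
      exact this.symm.trans (by ring)
    have h4 : ‖G y - G x₀‖ ^ 2 = ‖((‖G y - G x₀‖ ^ 2 : ℝ) : ℂ)‖ := by
      rw [Complex.norm_real, Real.norm_of_nonneg (by positivity)]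
    rw [h4, h3]
    refine (norm_sub_le _ _).trans ((add_le_add h1 h2).trans_eq (by ring))
  have hlim : Tendsto (fun y => ‖G y - G x₀‖ ^ 2) (𝓝 x₀) (𝓝 0) := by
    refine squeeze_zero' (Eventually.of_forall fun y => by positivity)
      (by filter_upwards [Metric.ball_mem_nhds x₀ hρ] with y hy using hsq y hy) ?_
    have : ContinuousAt (fun y => (4 * C ^ 2) / ρ * dist y x₀) x₀ := by fun_prop
    simpa [ContinuousAt] using this
  rw [ContinuousAt, tendsto_iff_norm_sub_tendsto_zero]
  simpa using hlim.sqrt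

/-- A locally bounded map to a Hilbert space whose inner products with its own values are
holomorphic is holomorphic. -/
lemma differentiableAt_of_differentiableOn_inner [CompleteSpace H] {U : Set ℂ} (hU : IsOpen U)
    {G : ℂ → H} (hG : ∀ x ∈ U, DifferentiableOn ℂ (fun y => inner ℂ (G x) (G y)) U)
    (hb : ∀ x ∈ U, ∃ C, ∀ᶠ y in 𝓝 x, ‖G y‖ ≤ C) {x₀ : ℂ} (hx₀ : x₀ ∈ U) :
    DifferentiableAt ℂ G x₀ := by
  have hcont : ContinuousOn G U := fun x hx => by
    obtain ⟨C, hC⟩ := hb x hx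
    exact (continuousAt_of_differentiableOn_inner hU hG hx hC).continuousWithinAt
  obtain ⟨R, hR, hRU⟩ := Metric.nhds_basis_closedBall.mem_iff.1 (hU.mem_nhds hx₀)
  lift R to NNReal using hR.le
  have hint : CircleIntegrable G x₀ R :=
    (hcont.mono (Metric.sphere_subset_closedBall.trans hRU)).circleIntegrable R.coe_nonneg
  have hps := hasFPowerSeriesOn_cauchy_integral hint hR
  refine hps.analyticAt.differentiableAt.congr_of_eventuallyEq ?_
  filter_upwards [Metric.ball_mem_nhds x₀ hR] with w hw
  have hint' : CircleIntegrable (fun ζ => (ζ - w)⁻¹ • G ζ) x₀ R := by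
    refine ContinuousOn.circleIntegrable R.coe_nonneg (ContinuousOn.smul ?_
      (hcont.mono (Metric.sphere_subset_closedBall.trans hRU)))
    refine ContinuousOn.inv₀ (by fun_prop) fun ζ hζ h => ?_
    rw [sub_eq_zero] at h
    rw [h] at hζ
    exact (ne_of_lt hw) hζ
  have hL : ∀ L : H →L[ℂ] ℂ, L ((2 * Real.pi * Complex.I : ℂ)⁻¹ • ∮ ζ in C(x₀, R), (ζ - w)⁻¹ • G ζ) =
      (2 * Real.pi * Complex.I : ℂ)⁻¹ • ∮ ζ in C(x₀, R), (ζ - w)⁻¹ • L (G ζ) := by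
    intro L
    rw [map_smul]
    congr 1
    simp only [circleIntegral]
    rw [← L.intervalIntegral_comp_comm hint'.out]
    simp
  -- The defect in the vector-valued Cauchy formula. The scalar formula makes it orthogonal to every
  -- value of `G`; being built from such values by integration, it is then orthogonal to itself.
  set d := (2 * Real.pi * Complex.I : ℂ)⁻¹ • (∮ ζ in C(x₀, R), (ζ - w)⁻¹ • G ζ) - G w with hd
  have h1 : ∀ x ∈ U, inner ℂ (G x) d = 0 := by
    intro x hx
    have h2 := hL (innerSL ℂ (G x))
    have h3 : DiffContOnCl ℂ (fun y => inner ℂ (G x) (G y)) (Metric.ball x₀ R) :=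
      (hG x hx).diffContOnCl_ball hRU
    have h4 := h3.two_pi_i_inv_smul_circleIntegral_sub_inv_smul hw
    simp only [innerSL_apply_apply] at h2
    rw [hd, inner_sub_right, h2, h4, sub_self]
  have h2 : inner ℂ d d = 0 := by
    have h3 := hL (innerSL ℂ d)
    simp only [innerSL_apply_apply] at h3
    have h4 : ∀ x ∈ U, inner ℂ d (G x) = 0 := fun x hx => inner_eq_zero_symm.1 (h1 x hx)
    conv_lhs => rw [hd]
    rw [inner_sub_right, ← hd, h4 w (hRU (Metric.ball_subset_closedBall hw)), h3, sub_zero]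
    rw [circleIntegral.integral_congr (g := fun _ => 0) R.coe_nonneg
      (fun ζ hζ => by simp [h4 ζ (hRU (Metric.sphere_subset_closedBall hζ))])]
    simp [circleIntegral]
  exact (sub_eq_zero.1 (inner_self_eq_zero.1 h2)).symm

/-- A bounded holomorphic map on a punctured neighbourhood of `0`, not identically zero, is a
power of the variable times a holomorphic map which does not vanish at `0`. -/
lemma exists_eventually_eq_pow_smul [CompleteSpace H] {G : ℂ → H}
    (hd : ∀ᶠ x in 𝓝[≠] (0 : ℂ), DifferentiableAt ℂ G x) {C : ℝ}
    (hb : ∀ᶠ x in 𝓝[≠] (0 : ℂ), ‖G x‖ ≤ C) (hne : ∀ᶠ x in 𝓝[≠] (0 : ℂ), G x ≠ 0) :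
    ∃ (m : ℕ) (g : ℂ → H), AnalyticAt ℂ g 0 ∧ g 0 ≠ 0 ∧
      ∀ᶠ x in 𝓝[≠] (0 : ℂ), G x = x ^ m • g x := by
  have hd' := eventually_nhdsWithin_iff.1 hd
  have hb' : IsBoundedUnder (· ≤ ·) (𝓝[≠] (0 : ℂ)) fun z => ‖G z - G 0‖ :=
    ⟨C + ‖G 0‖, eventually_map.2 (hb.mono fun x hx => norm_sub_le_of_le hx le_rfl)⟩
  -- Removable singularity: boundedness makes `G` extend holomorphically by its limit at 0.
  have hdiff := Complex.differentiableOn_update_limUnder_of_isLittleO hd'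
    (fun x hx => (hx.1 hx.2).differentiableWithinAt) hb'.isLittleO_sub_self_inv
  have han : AnalyticAt ℂ (Function.update G 0 (limUnder (𝓝[≠] 0) G)) 0 :=
    hdiff.analyticAt hd'
  have hupd : ∀ᶠ x in 𝓝[≠] (0 : ℂ), Function.update G 0 (limUnder (𝓝[≠] 0) G) x = G x := by
    filter_upwards [self_mem_nhdsWithin] with x hx
    exact Function.update_of_ne hx _ _
  obtain ⟨m, g, hg, hg0, heq⟩ := han.exists_eventuallyEq_pow_smul_nonzero_iff.2 (by
    intro h
    obtain ⟨x, h1, h2, h3⟩ := ((h.filter_mono nhdsWithin_le_nhds).and (hupd.and hne)).exists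
    exact h3 (h2 ▸ h1))
  refine ⟨m, g, hg, hg0, ?_⟩
  filter_upwards [hupd, heq.filter_mono nhdsWithin_le_nhds] with x h1 h2
  rw [← h1, h2, sub_zero]

/-- `innerSL` is conjugate-linear in its vector, and this cancels the conjugation of the variable.
-/
lemma hasDerivAt_innerSL_conj {g : ℂ → H} {g' : H} {x : ℂ} (hg : HasDerivAt g g' (conj x)) :
    HasDerivAt (fun y => innerSL ℂ (g (conj y))) (innerSL ℂ g') x := by
  rw [hasDerivAt_iff_tendsto_slope] at hg ⊢
  have hconj : Tendsto (fun y : ℂ => conj y) (𝓝[≠] x) (𝓝[≠] (conj x)) :=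
    Complex.continuous_conj.continuousWithinAt.tendsto_nhdsWithin fun y hy h =>
      hy ((starRingEnd ℂ).injective h)
  have h := ((innerSL ℂ (E := H)).continuous.tendsto g').comp (hg.comp hconj)
  refine h.congr fun y => ?_
  simp [slope_def_module, map_smulₛₗ]

/-- Polarization of the squared norm of a holomorphic map, and its logarithm. -/
lemma exists_analyticAt_exp_eq_norm_sq [CompleteSpace H] {g : ℂ → H} (hg : AnalyticAt ℂ g 0)
    (hg0 : g 0 ≠ 0) : ∃ F : ℂ × ℂ → ℂ, AnalyticAt ℂ F (0, 0) ∧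
      ∀ᶠ x : ℂ in 𝓝 0, Complex.exp (F (x, conj x)) = ((‖g (conj x)‖ ^ 2 : ℝ) : ℂ) := by
  have hc0 : conj (0 : ℂ) = 0 := map_zero _
  have hev : ∀ᶠ x : ℂ in 𝓝 0, AnalyticAt ℂ g (conj x) := by
    have := Complex.continuous_conj.tendsto 0
    rw [hc0] at this
    exact this.eventually hg.eventually_analyticAt
  have hL : AnalyticAt ℂ (fun x : ℂ => innerSL ℂ (g (conj x))) 0 := by
    rw [Complex.analyticAt_iff_eventually_differentiableAt]
    filter_upwards [hev] with x hx
    exact (hasDerivAt_innerSL_conj hx.differentiableAt.hasDerivAt).differentiableAt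
  -- The polarization ⟨g(conj p₁), g(p₂)⟩ restricts to ‖g(x̄)‖² at (x, x̄). Its value at the origin
  -- is ‖g 0‖² > 0, so the principal logarithm applies.
  have hP : AnalyticAt ℂ (fun p : ℂ × ℂ => (innerSL ℂ (g (conj p.1))) (g p.2)) (0, 0) := by
    have h1 : AnalyticAt ℂ (fun p : ℂ × ℂ => innerSL ℂ (g (conj p.1))) (0, 0) :=
      AnalyticAt.fun_comp (g := fun x : ℂ => innerSL ℂ (g (conj x))) (f := fun p : ℂ × ℂ => p.1)
        hL analyticAt_fst
    have h2 : AnalyticAt ℂ (fun p : ℂ × ℂ => g p.2) (0, 0) :=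
      AnalyticAt.fun_comp (g := g) (f := fun p : ℂ × ℂ => p.2) hg analyticAt_snd
    exact AnalyticAt.fun_comp (g := fun q : (H →L[ℂ] ℂ) × H => q.1 q.2)
      (ContinuousLinearMap.analyticAt_bilinear (ContinuousLinearMap.id ℂ (H →L[ℂ] ℂ)) _)
      (h1.prod h2)
  have hself : ∀ x, innerSL ℂ (g x) (g x) = ((‖g x‖ ^ 2 : ℝ) : ℂ) := fun x => by
    rw [innerSL_apply_apply, inner_self_eq_norm_sq_to_K]; push_cast; rfl
  refine ⟨fun p => Complex.log ((innerSL ℂ (g (conj p.1))) (g p.2)), hP.clog ?_, ?_⟩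
  · simp only [hc0]
    rw [hself, Complex.ofReal_mem_slitPlane]
    have := norm_pos_iff.2 hg0
    positivity
  · have hne : ∀ᶠ x : ℂ in 𝓝 0, g (conj x) ≠ 0 := by
      have h := (hg.continuousAt.eventually_ne hg0)
      have := Complex.continuous_conj.tendsto 0
      rw [hc0] at this
      exact this.eventually h
    filter_upwards [hne] with x hx
    simp only [hself]
    refine Complex.exp_log ?_
    have := norm_ne_zero_iff.2 hx
    exact_mod_cast pow_ne_zero 2 this

end HilbertValued

/-! ### A quadratic surface in the cone through a given line -/

/-- There is a vector of prescribed square `b · b`, orthogonal to `z` and to its conjugate. -/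
lemma exists_orthogonal (hn : 2 ≤ n) (z : Fin (n + 1) → ℂ) (s : ℂ) :
    ∃ b : Fin (n + 1) → ℂ, z ⬝ᵥ b = 0 ∧ star z ⬝ᵥ b = 0 ∧ b ⬝ᵥ b = s := by
  let L : (Fin (n + 1) → ℝ) →ₗ[ℝ] ℂ :=
    ∑ j, (LinearMap.proj j : (Fin (n + 1) → ℝ) →ₗ[ℝ] ℝ).smulRight (z j)
  -- Here n ≥ 2 enters: n + 1 real unknowns against two real equations. A real solution is
  -- orthogonal to z and to its conjugate at once and has nonzero square, so a complex multiple of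
  -- it has any prescribed square.
  have hker : LinearMap.ker L ≠ ⊥ := LinearMap.ker_ne_bot_of_finrank_lt (by
    rw [Complex.finrank_real_complex]; simp; omega)
  obtain ⟨v, hv, hv0⟩ := (Submodule.ne_bot_iff _).1 hker
  let w : Fin (n + 1) → ℂ := fun j => (v j : ℂ)
  have h1 : z ⬝ᵥ w = 0 := by
    have : L v = 0 := hv
    rw [← this]
    simp [L, dotProduct, w, mul_comm]
  have h2 : star z ⬝ᵥ w = 0 := by
    have h := congrArg conj h1
    rw [map_zero] at h
    rw [← h]
    simp [dotProduct, w]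
  have h3 : w ⬝ᵥ w ≠ 0 := by
    have h : w ⬝ᵥ w = ((v ⬝ᵥ v : ℝ) : ℂ) := by simp [dotProduct, w]
    rw [h, Complex.ofReal_ne_zero]
    exact fun h => hv0 (dotProduct_self_eq_zero.1 h)
  obtain ⟨r, hr⟩ := IsAlgClosed.exists_pow_nat_eq (s / (w ⬝ᵥ w)) two_pos
  refine ⟨r • w, by simp [h1], by simp [h2], ?_⟩
  rw [smul_dotProduct, dotProduct_smul, smul_smul, smul_eq_mul, ← pow_two, hr]
  field_simp

open scoped ComplexOrder in
/-- Through every line of the cone there is a quadratic image of `ℂ²` in the cone. -/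
lemma exists_quadratic_map (hn : 2 ≤ n) {z : EuclideanSpace ℂ (Fin (n + 1))} (hz : z ∈ ball n) :
    ∃ P : ℂ × ℂ → EuclideanSpace ℂ (Fin (n + 1)), Differentiable ℂ P ∧ (∀ s, P (s, 0) = s ^ 2 • z) ∧
      (∀ p, p ≠ 0 → ‖P p‖ < 1 → P p ∈ ball n) := by
  -- With P = s² z + s t b + t² z̄, the only surviving terms of P · P are s² t² (2 z · z̄ + b · b),
  -- whence the value -2 z · z̄.
  obtain ⟨b, hb1, hb2, hb3⟩ := exists_orthogonal hn z.ofLp (-2 * (z.ofLp ⬝ᵥ star z.ofLp))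
  have hz0 : z.ofLp ⬝ᵥ z.ofLp = 0 := hz.1
  have hz1 : star z.ofLp ⬝ᵥ star z.ofLp = 0 := by
    have : star z.ofLp ⬝ᵥ star z.ofLp = star (z.ofLp ⬝ᵥ z.ofLp) := by simp [dotProduct]
    rw [this, hz0, star_zero]
  have hzz : z.ofLp ⬝ᵥ star z.ofLp ≠ 0 := by
    rw [Ne, dotProduct_self_star_eq_zero]
    exact fun h => hz.2.1 (by ext i; simp [h])
  have hc1 : b ⬝ᵥ z.ofLp = 0 := by rw [dotProduct_comm, hb1]
  have hc2 : b ⬝ᵥ star z.ofLp = 0 := by rw [dotProduct_comm, hb2]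
  have hc3 : star z.ofLp ⬝ᵥ z.ofLp = z.ofLp ⬝ᵥ star z.ofLp := dotProduct_comm _ _
  let P : ℂ × ℂ → EuclideanSpace ℂ (Fin (n + 1)) := fun p =>
    p.1 ^ 2 • z + (p.1 * p.2) • WithLp.toLp 2 b + p.2 ^ 2 • WithLp.toLp 2 (star z.ofLp)
  have hP : ∀ p, (P p).ofLp = p.1 ^ 2 • z.ofLp + (p.1 * p.2) • b + p.2 ^ 2 • star z.ofLp :=
    fun p => rfl
  refine ⟨P, by fun_prop, fun s => by simp [P], fun p hp hp1 => ⟨?_, fun h => hp ?_, hp1⟩⟩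
  · change (P p).ofLp ⬝ᵥ (P p).ofLp = 0
    rw [hP]
    simp only [add_dotProduct, dotProduct_add, smul_dotProduct, dotProduct_smul, smul_eq_mul,
      hz0, hz1, hb1, hb2, hb3, hc1, hc2, hc3]
    ring
  · have h0 : (P p).ofLp = 0 := by rw [h]; rfl
    -- Pairing P with z and z̄ recovers t² and s², so P vanishes only at the origin.
    have h1 : z.ofLp ⬝ᵥ (P p).ofLp = p.2 ^ 2 * (z.ofLp ⬝ᵥ star z.ofLp) := by
      rw [hP]
      simp [dotProduct_add, dotProduct_smul, hz0, hb1]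
    have h2 : star z.ofLp ⬝ᵥ (P p).ofLp = p.1 ^ 2 * (z.ofLp ⬝ᵥ star z.ofLp) := by
      rw [hP]
      simp [dotProduct_add, dotProduct_smul, hz1, hb2, hc3]
    rw [h0, dotProduct_zero] at h1 h2
    have e1 := (mul_eq_zero.1 h1.symm).resolve_right hzz
    have e2 := (mul_eq_zero.1 h2.symm).resolve_right hzz
    exact Prod.ext (pow_eq_zero_iff two_ne_zero |>.1 e2) (pow_eq_zero_iff two_ne_zero |>.1 e1)

/-! ### The kernel along lines -/

/-- The feature map of the reproducing kernel. -/
lemma exists_feature_map {u : EuclideanSpace ℂ (Fin (n + 1)) → ℝ}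
    {K : EuclideanSpace ℂ (Fin (n + 1)) → EuclideanSpace ℂ (Fin (n + 1)) → ℂ}
    (hK : IsBergmanKernel n u K) :
    ∃ κ : EuclideanSpace ℂ (Fin (n + 1)) → Lp ℂ 2 (weightedVolume n u),
      ∀ x ∈ ball n, ∀ y ∈ ball n, inner ℂ (κ y) (κ x) = K y x := by
  classical
  refine ⟨fun x => if h : x ∈ ball n then (hK.mem x h).2.toLp else 0, fun x hx y hy => ?_⟩
  simp only [dif_pos hx, dif_pos hy]
  rw [L2.inner_def, hK.reproducing _ (hK.mem x hx) y hy]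
  refine integral_congr_ae ?_
  filter_upwards [(hK.mem x hx).2.coeFn_toLp, (hK.mem y hy).2.coeFn_toLp] with w h1 h2
  rw [h1, h2]
  rfl

section

variable {u : EuclideanSpace ℂ (Fin (n + 1)) → ℝ}
  {K : EuclideanSpace ℂ (Fin (n + 1)) → EuclideanSpace ℂ (Fin (n + 1)) → ℂ}
  {H : Type*} [NormedAddCommGroup H] [InnerProductSpace ℂ H]
  {κ : EuclideanSpace ℂ (Fin (n + 1)) → H}

lemma norm_sq_feature_map (hκ : ∀ x ∈ ball n, ∀ y ∈ ball n, inner ℂ (κ y) (κ x) = K y x)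
    {c : ℝ} (hbal : ∀ z ∈ ball n, K z z = ((c / u z ^ (n + 1) : ℝ) : ℂ))
    {z : EuclideanSpace ℂ (Fin (n + 1))} (hz : z ∈ ball n) :
    ‖κ z‖ ^ 2 = c / u z ^ (n + 1) := by
  have h := inner_self_eq_norm_sq_to_K (𝕜 := ℂ) (κ z)
  rw [hκ z hz z hz, hbal z hz] at h
  refine Complex.ofReal_injective ?_
  rw [h, Complex.ofReal_pow]
  rfl

/-- The definition of the kernel gives no continuity on the diagonal; balance transfers it from `u`.
-/
lemma continuousOn_norm_feature_map (hu : IsAdmissible n u)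
    (hκ : ∀ x ∈ ball n, ∀ y ∈ ball n, inner ℂ (κ y) (κ x) = K y x)
    {c : ℝ} (hbal : ∀ z ∈ ball n, K z z = ((c / u z ^ (n + 1) : ℝ) : ℂ)) :
    ContinuousOn (fun z => ‖κ z‖) (ball n) := by
  have h : ContinuousOn (fun z => √(c / u z ^ (n + 1))) (ball n) :=
    (continuousOn_const.div (hu.continuousOn.pow _) fun z hz =>
      pow_ne_zero _ (hu.pos z hz).ne').sqrt
  refine h.congr fun z hz => ?_
  simp only
  rw [← norm_sq_feature_map hκ hbal hz, Real.sqrt_sq (norm_nonneg _)]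

/-- The kernel is bounded near the vertex along lines. -/
lemma exists_bound_feature_map (hn : 2 ≤ n) (hu : IsAdmissible n u)
    (hholo : ∀ x ∈ ball n, IsHolo n fun y => K y x)
    (hκ : ∀ x ∈ ball n, ∀ y ∈ ball n, inner ℂ (κ y) (κ x) = K y x)
    {c : ℝ} (hbal : ∀ z ∈ ball n, K z z = ((c / u z ^ (n + 1) : ℝ) : ℂ))
    {z : EuclideanSpace ℂ (Fin (n + 1))} (hz : z ∈ ball n) :
    ∃ C, ∀ᶠ y : ℂ in 𝓝[≠] 0, ‖κ (y • z)‖ ≤ C := by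
  obtain ⟨P, hP, hPz, hPmem⟩ := exists_quadratic_map hn hz
  have hP0 : P 0 = 0 := by
    have := hPz 0
    simpa [← Prod.zero_eq_mk] using this
  have hsmall : ∀ᶠ p in 𝓝 (0 : ℂ × ℂ), ‖P p‖ < 1 :=
    hP.continuous.norm.continuousAt.eventually (gt_mem_nhds (by simp [hP0]))
  obtain ⟨R, hR, hball⟩ := Metric.nhds_basis_ball.eventually_iff.1 hsmall
  obtain ⟨r, hr, hrR⟩ := exists_between hR
  have hlt : ∀ s t : ℂ, ‖s‖ < R → ‖t‖ < R → ‖P (s, t)‖ < 1 := fun s t hs ht =>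
    hball (by rw [mem_ball_zero_iff, Prod.norm_def]; exact max_lt hs ht)
  have hcomp : IsCompact (Metric.closedBall (0 : ℂ) r ×ˢ Metric.sphere (0 : ℂ) r) :=
    (isCompact_closedBall _ _).prod (isCompact_sphere _ _)
  have hmaps : ∀ p ∈ Metric.closedBall (0 : ℂ) r ×ˢ Metric.sphere (0 : ℂ) r, P p ∈ ball n := by
    rintro ⟨s, t⟩ ⟨hs, ht⟩
    rw [mem_closedBall_zero_iff] at hs
    rw [mem_sphere_zero_iff_norm] at ht
    refine hPmem _ (fun h => ?_) (hlt s t (hs.trans_lt hrR) (ht.trans_lt hrR))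
    have : t = 0 := congrArg Prod.snd h
    rw [this, norm_zero] at ht
    exact hr.ne ht
  obtain ⟨C, hC⟩ := hcomp.exists_bound_of_continuousOn
    ((continuousOn_norm_feature_map hu hκ hbal).comp hP.continuous.continuousOn hmaps)
  -- On the disc t ↦ P(s, t), the function K(·, s² z) equals ‖κ(s² z)‖² at the centre, and
  -- Cauchy–Schwarz bounds it by C ‖κ(s² z)‖ on the boundary. The maximum principle allows
  -- cancelling one factor.
  have key : ∀ s : ℂ, s ≠ 0 → ‖s‖ < r → ‖κ (s ^ 2 • z)‖ ≤ C := by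
    intro s hs hsr
    have hPs : ∀ t, ‖t‖ < R → P (s, t) ∈ ball n := fun t ht =>
      hPmem _ (fun h => hs (congrArg Prod.fst h)) (hlt s t (hsr.trans hrR) ht)
    have hw : s ^ 2 • z ∈ ball n := by
      rw [← hPz]; exact hPs 0 (by simpa using hR)
    have hd : ∀ t, ‖t‖ < R → DifferentiableAt ℂ (fun t => K (P (s, t)) (s ^ 2 • z)) t := by
      intro t ht
      refine (hholo _ hw).differentiableAt_comp (γ := fun t => P (s, t)) (by fun_prop) ?_
      filter_upwards [continuous_norm.continuousAt.eventually (gt_mem_nhds ht)] with t' ht'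
      exact hPs t' ht'
    have hKle : ∀ t, ‖t‖ = r → ‖K (P (s, t)) (s ^ 2 • z)‖ ≤ C * ‖κ (s ^ 2 • z)‖ := by
      intro t ht
      rw [← hκ _ hw _ (hPs t (ht.trans_lt hrR))]
      refine (norm_inner_le_norm _ _).trans ?_
      gcongr
      simpa using hC (s, t) ⟨by simpa using hsr.le, by simpa using ht⟩
    have hdc : DiffContOnCl ℂ (fun t => K (P (s, t)) (s ^ 2 • z)) (Metric.ball 0 r) :=
      DifferentiableOn.diffContOnCl_ball (U := Metric.ball 0 R)
        (fun t ht => (hd t (by simpa using ht)).differentiableWithinAt)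
        (Metric.closedBall_subset_ball hrR)
    have hmax := Complex.norm_le_of_forall_mem_frontier_norm_le Metric.isBounded_ball hdc
      (C := C * ‖κ (s ^ 2 • z)‖) (fun t ht => hKle t (by
        rw [frontier_ball _ hr.ne'] at ht; simpa using ht))
      (subset_closure (Metric.mem_ball_self hr))
    rw [hPz, ← hκ _ hw _ hw, inner_self_eq_norm_sq_to_K] at hmax
    have hmax' : ‖κ (s ^ 2 • z)‖ * ‖κ (s ^ 2 • z)‖ ≤ C * ‖κ (s ^ 2 • z)‖ := by
      simpa [pow_two] using hmax
    by_cases h0 : ‖κ (s ^ 2 • z)‖ = 0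
    · rw [h0]
      exact (norm_nonneg _).trans (hC (0, (r : ℂ)) ⟨by simp [hr.le], by simp [hr.le]⟩)
    · exact le_of_mul_le_mul_right hmax' (lt_of_le_of_ne (norm_nonneg _) (Ne.symm h0))
  refine ⟨C, ?_⟩
  rw [eventually_nhdsWithin_iff]
  filter_upwards [Metric.ball_mem_nhds (0 : ℂ) (pow_pos hr 2)] with y hy hy0
  obtain ⟨s, rfl⟩ := IsAlgClosed.exists_pow_nat_eq y two_pos
  refine key s (by rintro rfl; simp at hy0) ?_
  rw [mem_ball_zero_iff, norm_pow] at hy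
  exact lt_of_pow_lt_pow_left₀ 2 hr.le hy

/-- Along a line through the vertex, the feature map is antiholomorphic. -/
lemma differentiableAt_feature_map [CompleteSpace H] (hu : IsAdmissible n u)
    (hholo : ∀ x ∈ ball n, IsHolo n fun y => K y x)
    (hκ : ∀ x ∈ ball n, ∀ y ∈ ball n, inner ℂ (κ y) (κ x) = K y x)
    {c : ℝ} (hbal : ∀ z ∈ ball n, K z z = ((c / u z ^ (n + 1) : ℝ) : ℂ))
    {z : EuclideanSpace ℂ (Fin (n + 1))} (hz : z ∈ ball n) {y : ℂ} (hy : y ≠ 0)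
    (hy1 : ‖y‖ * ‖z‖ < 1) : DifferentiableAt ℂ (fun y : ℂ => κ (conj y • z)) y := by
  set U : Set ℂ := {y | y ≠ 0} ∩ {y | ‖y‖ * ‖z‖ < 1} with hUdef
  have hU : IsOpen U := isOpen_ne.inter (isOpen_lt (by fun_prop) continuous_const)
  have hmem : ∀ y ∈ U, conj y • z ∈ ball n := fun y hy =>
    smul_mem_ball hz (by simpa using hy.1) (by simpa using hy.2)
  refine differentiableAt_of_differentiableOn_inner hU (fun x hx y hy => ?_) (fun x hx => ?_)
    ⟨hy, hy1⟩
  · have h1 : DifferentiableAt ℂ (fun w : ℂ => K (w • z) (conj x • z)) (conj y) := by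
      refine (hholo _ (hmem x hx)).differentiableAt_comp (γ := fun w : ℂ => w • z) (by fun_prop) ?_
      have h2 : ∀ᶠ w in 𝓝 (conj y), w ∈ U :=
        hU.mem_nhds ⟨by simpa using hy.1, by simpa using hy.2⟩
      filter_upwards [h2] with w hw using smul_mem_ball hz hw.1 hw.2
    have h2 := h1.conj_conj
    rw [Complex.conj_conj] at h2
    refine (h2.congr_of_eventuallyEq ?_).differentiableWithinAt
    filter_upwards [hU.mem_nhds hy] with w hw
    rw [← inner_conj_symm, hκ _ (hmem x hx) _ (hmem w hw)]
    rfl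
  · have h1 : ContinuousAt (fun y : ℂ => ‖κ (conj y • z)‖) x := by
      have h2 : ContinuousOn (fun y : ℂ => ‖κ (conj y • z)‖) U :=
        (continuousOn_norm_feature_map hu hκ hbal).comp
          ((Complex.continuous_conj.smul continuous_const).continuousOn) hmem
      exact h2.continuousAt (hU.mem_nhds hx)
    exact ⟨‖κ (conj x • z)‖ + 1, (h1.eventually (gt_mem_nhds (lt_add_one _))).mono fun _ h => h.le⟩

/-- The feature map along a line through the vertex is a power times a nonvanishing map. -/
lemma exists_feature_map_eq_pow_smul [CompleteSpace H] (hn : 2 ≤ n) (hu : IsAdmissible n u)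
    (hholo : ∀ x ∈ ball n, IsHolo n fun y => K y x)
    (hκ : ∀ x ∈ ball n, ∀ y ∈ ball n, inner ℂ (κ y) (κ x) = K y x)
    {c : ℝ} (hc : c ≠ 0) (hbal : ∀ z ∈ ball n, K z z = ((c / u z ^ (n + 1) : ℝ) : ℂ))
    {z : EuclideanSpace ℂ (Fin (n + 1))} (hz : z ∈ ball n) :
    ∃ (m : ℕ) (g : ℂ → H), AnalyticAt ℂ g 0 ∧ g 0 ≠ 0 ∧ ∀ᶠ x : ℂ in 𝓝[≠] 0,
      x • z ∈ ball n ∧ ‖κ (x • z)‖ ^ 2 = ‖x‖ ^ (2 * m) * ‖g (conj x)‖ ^ 2 := by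
  have hconj : Tendsto (fun y : ℂ => conj y) (𝓝[≠] 0) (𝓝[≠] 0) := by
    have h := Complex.continuous_conj.continuousWithinAt (s := {(0 : ℂ)}ᶜ)
      (x := 0) |>.tendsto_nhdsWithin (t := {(0 : ℂ)}ᶜ) fun y hy => by simpa using hy
    simpa using h
  have hmem : ∀ᶠ x : ℂ in 𝓝[≠] 0, x ≠ 0 ∧ ‖x‖ * ‖z‖ < 1 := by
    have h : ∀ᶠ x : ℂ in 𝓝 0, ‖x‖ * ‖z‖ < 1 :=
      (show Continuous fun w : ℂ => ‖w‖ * ‖z‖ by fun_prop).continuousAt.eventually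
        (gt_mem_nhds (by simp))
    filter_upwards [self_mem_nhdsWithin, h.filter_mono nhdsWithin_le_nhds] with x hx hx'
    exact ⟨hx, hx'⟩
  obtain ⟨C, hC⟩ := exists_bound_feature_map hn hu hholo hκ hbal hz
  obtain ⟨m, g, hg, hg0, heq⟩ := exists_eventually_eq_pow_smul (G := fun y : ℂ => κ (conj y • z))
    (hmem.mono fun y hy => differentiableAt_feature_map hu hholo hκ hbal hz hy.1 hy.2)
    (hconj.eventually hC) (hmem.mono fun y hy h => by
      have hb := smul_mem_ball hz (y := conj y) (by simpa using hy.1) (by simpa using hy.2)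
      have := norm_sq_feature_map hκ hbal hb
      rw [h, norm_zero, zero_pow two_ne_zero] at this
      exact div_ne_zero hc (pow_ne_zero _ (hu.pos _ hb).ne') this.symm)
  refine ⟨m, g, hg, hg0, ?_⟩
  filter_upwards [hmem, hconj.eventually heq] with x hx hx'
  refine ⟨smul_mem_ball hz hx.1 hx.2, ?_⟩
  rw [Complex.conj_conj] at hx'
  rw [hx', norm_smul, norm_pow, Complex.norm_conj]
  ring

/-- The potential has bounded radial Laplacian near the vertex. -/
lemma exists_bound_laplacian [CompleteSpace H] {z : EuclideanSpace ℂ (Fin (n + 1))}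
    (hpos : ∀ z ∈ ball n, 0 < u z) {c : ℝ} (hc : c ≠ 0)
    (hκ : ∀ z ∈ ball n, ‖κ z‖ ^ 2 = c / u z ^ (n + 1))
    {m : ℕ} {g : ℂ → H} (hg : AnalyticAt ℂ g 0) (hg0 : g 0 ≠ 0)
    (heq : ∀ᶠ x : ℂ in 𝓝[≠] 0,
      x • z ∈ ball n ∧ ‖κ (x • z)‖ ^ 2 = ‖x‖ ^ (2 * m) * ‖g (conj x)‖ ^ 2) :
    ∃ C, ∀ᶠ x : ℂ in 𝓝[≠] 0, Δ (fun w : ℂ => -Real.log (u (w • z))) x ≤ C := by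
  have hc0 : conj (0 : ℂ) = 0 := map_zero _
  -- The part of Φ(xz) that is C² across 0; what remains is a multiple of log |x|.
  set S : ℂ → ℝ := fun x => (1 / (n + 1 : ℝ)) * Real.log (‖g (conj x)‖ ^ 2) +
    -((1 / (n + 1 : ℝ)) * Real.log c) with hS
  have hSsmooth : ContDiffAt ℝ 2 S 0 := by
    have h1 : ContDiffAt ℝ 2 (fun x : ℂ => g (conj x)) 0 := by
      refine ContDiffAt.comp (𝕜 := ℝ) (g := g) (f := fun x : ℂ => conj x) 0 ?_
        Complex.conjCLE.contDiff.contDiffAt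
      rw [hc0]
      exact (hg.restrictScalars (𝕜 := ℝ)).contDiffAt
    refine (contDiffAt_const.mul (ContDiffAt.log (h1.norm_sq ℂ) ?_)).add contDiffAt_const
    rw [hc0]
    simpa using hg0
  have hΔcont : ContinuousAt (Δ S) 0 := by
    have h : ContinuousAt (iteratedFDeriv ℝ 2 S) 0 := by
      exact hSsmooth.continuousAt_iteratedFDeriv le_rfl
    rw [InnerProductSpace.laplacian_eq_iteratedFDeriv_complexPlane]
    exact ((ContinuousMultilinearMap.apply ℝ _ _ ![1, 1]).continuous.continuousAt.comp h).add
      ((ContinuousMultilinearMap.apply ℝ _ _ ![Complex.I, Complex.I]).continuous.continuousAt.comp h)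
  refine ⟨Δ S 0 + 1, ?_⟩
  have hgne : ∀ᶠ x : ℂ in 𝓝 0, g (conj x) ≠ 0 := by
    have h := (hg.continuousAt.eventually_ne hg0)
    have := Complex.continuous_conj.tendsto 0
    rw [hc0] at this
    exact this.eventually h
  have hE := eventually_eventually_nhdsWithin.2 heq
  filter_upwards [hE, self_mem_nhdsWithin,
    (hΔcont.eventually (gt_mem_nhds (lt_add_one _))).filter_mono nhdsWithin_le_nhds,
    (hSsmooth.eventually (by simp)).filter_mono nhdsWithin_le_nhds,
    hgne.eventually_nhds.filter_mono nhdsWithin_le_nhds] with x hx hx0 hΔ hSx hgx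
  have hx0' : x ≠ 0 := hx0
  rw [nhdsWithin_eq_nhds.2 (isOpen_compl_singleton.mem_nhds hx0)] at hx
  have hharm : InnerProductSpace.HarmonicAt (fun w : ℂ => Real.log ‖w‖) x :=
    analyticAt_id.harmonicAt_log_norm hx0'
  have hfun : (fun w : ℂ => -Real.log (u (w • z))) =ᶠ[𝓝 x]
      ((2 * m / (n + 1 : ℝ)) • fun w : ℂ => Real.log ‖w‖) + S := by
    filter_upwards [hx, hgx, isOpen_ne.mem_nhds hx0'] with w hw hgw hw0
    have hup := hpos _ hw.1
    have hκw := hκ _ hw.1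
    rw [hw.2] at hκw
    have h1 : Real.log (‖w‖ ^ (2 * m) * ‖g (conj w)‖ ^ 2) =
        (2 * m : ℕ) * Real.log ‖w‖ + Real.log (‖g (conj w)‖ ^ 2) := by
      rw [Real.log_mul (pow_ne_zero _ (norm_ne_zero_iff.2 hw0))
        (pow_ne_zero _ (norm_ne_zero_iff.2 hgw)), Real.log_pow]
    have h2 : Real.log (c / u (w • z) ^ (n + 1)) =
        Real.log c - (n + 1 : ℕ) * Real.log (u (w • z)) := by
      rw [Real.log_div hc (pow_ne_zero _ hup.ne'), Real.log_pow]
    rw [hκw, h2] at h1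
    simp only [Pi.add_apply, Pi.smul_apply, smul_eq_mul, hS]
    push_cast at h1
    field_simp
    linarith
  have e1 := (InnerProductSpace.laplacian_congr_nhds hfun).self_of_nhds
  have hlog : ContDiffAt ℝ 2 ((2 * m / (n + 1 : ℝ)) • fun w : ℂ => Real.log ‖w‖) x :=
    contDiffAt_const.smul hharm.1
  rw [e1, hlog.laplacian_add hSx,
    InnerProductSpace.laplacian_smul _ hharm.1, hharm.2.self_of_nhds]
  simpa using hΔ.le

end

/-! ### Radial lengths and incompleteness -/

/-- Near the vertex the Laplacian bound controls the Levi form; on [δ, 1] compactness does, as the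
segment up to t = 1 stays in the ball because ‖z‖ < 1. -/
lemma exists_bound_metricNorm_radial {u : EuclideanSpace ℂ (Fin (n + 1)) → ℝ}
    (hu : IsAdmissible n u) {z : EuclideanSpace ℂ (Fin (n + 1))} (hz : z ∈ ball n)
    (hΔ : ∃ C, ∀ᶠ x : ℂ in 𝓝[≠] 0, Δ (fun w : ℂ => -Real.log (u (w • z))) x ≤ C) :
    ∃ C : ℝ, ∀ t ∈ Set.Ioc (0 : ℝ) 1, ∀ s : ℝ,
      metricNorm n u (t • z) (s • z) ≤ ENNReal.ofReal (|s| * C) := by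
  obtain ⟨j, hj⟩ := exists_coord_ne_zero hz
  obtain ⟨C₁, hC₁⟩ := hΔ
  rw [eventually_nhdsWithin_iff] at hC₁
  obtain ⟨δ, hδ, hball⟩ := Metric.eventually_nhds_iff_ball.1 hC₁
  have hlt : ∀ t ∈ Set.Ioc (0 : ℝ) 1, t * ‖z‖ < 1 := fun t ht =>
    (mul_le_of_le_one_left (norm_nonneg z) ht.2).trans_lt hz.2.2
  have hlt' : ∀ t ∈ Set.Ioc (0 : ℝ) 1, ‖(t : ℂ)‖ * ‖z‖ < 1 := fun t ht => by
    simpa [abs_of_pos ht.1] using hlt t ht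
  set l : ℝ → ℝ := fun t =>
    leviForm (potential u (graphMap (z j) j)) ((t : ℂ) • dropCoord j z) (dropCoord j z)
  have hcont : ContinuousOn l (Set.Icc δ 1) :=
    (continuousOn_leviForm (isOpen_graphDomain (z j) j)
      (hu.contDiff _ _ (isChart_graphMap hj j))).comp
      (f := fun t : ℝ => ((t : ℂ) • dropCoord j z, dropCoord j z))
      (Continuous.continuousOn (by fun_prop)) fun t ht =>
        ⟨smul_dropCoord_mem hz hj (by simpa using hδ.trans_le ht.1)
          (hlt' t ⟨hδ.trans_le ht.1, ht.2⟩), trivial⟩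
  obtain ⟨C₂, hC₂⟩ := isCompact_Icc.exists_bound_of_continuousOn hcont
  refine ⟨√(max (C₁ / 4) C₂), fun t ht s => (metricNorm_radial_le u hz hj ht.1 (hlt t ht) s).trans
    (ENNReal.ofReal_le_ofReal ?_)⟩
  gcongr
  rcases lt_or_ge t δ with h | h
  · refine le_max_of_le_left ?_
    have h1 := four_mul_leviForm_radial hu hz hj (y := (t : ℂ)) (by simpa using ht.1) (hlt' t ht)
    have h2 := hball (t : ℂ) (by simpa [abs_of_pos ht.1] using h) (by simpa using ht.1.ne')
    linarith
  · exact le_max_of_le_right ((le_abs_self _).trans (hC₂ t ⟨h, ht.2⟩))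

lemma curveLength_radial_lt_top {u : EuclideanSpace ℂ (Fin (n + 1)) → ℝ}
    {z : EuclideanSpace ℂ (Fin (n + 1))} {C : ℝ}
    (hC : ∀ t ∈ Set.Ioc (0 : ℝ) 1, ∀ s : ℝ,
      metricNorm n u (t • z) (s • z) ≤ ENNReal.ofReal (|s| * C)) :
    curveLength n u (fun x : ℝ => x • z) < ⊤ := by
  have h : curveLength n u (fun x : ℝ => x • z) ≤
      ∫⁻ _ in Set.Ioo (0 : ℝ) 1, ENNReal.ofReal (|1| * C) := by
    refine setLIntegral_mono' measurableSet_Ioo fun t ht => ?_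
    have hd : deriv (fun x : ℝ => x • z) t = (1 : ℝ) • z :=
      ((hasDerivAt_id t).smul_const z).deriv
    rw [hd]
    exact hC t ⟨ht.1, ht.2.le⟩ 1
  refine h.trans_lt ?_
  simp

lemma metricDist_radial_le {u : EuclideanSpace ℂ (Fin (n + 1)) → ℝ}
    {z : EuclideanSpace ℂ (Fin (n + 1))} (hz : z ∈ ball n) {C : ℝ}
    (hC : ∀ t ∈ Set.Ioc (0 : ℝ) 1, ∀ s : ℝ,
      metricNorm n u (t • z) (s • z) ≤ ENNReal.ofReal (|s| * C))
    {x y : ℝ} (hx : x ∈ Set.Ioc (0 : ℝ) 1) (hy : y ∈ Set.Ioc (0 : ℝ) 1) :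
    metricDist n u (x • z) (y • z) ≤ ENNReal.ofReal (|y - x| * C) := by
  have hmem : ∀ t ∈ Set.Icc (0 : ℝ) 1, x + t * (y - x) ∈ Set.Ioc (0 : ℝ) 1 := fun t ht => by
    have := (convex_Ioc (0 : ℝ) 1).add_smul_sub_mem hx hy ht
    simpa using this
  have hball : ∀ t ∈ Set.Ioc (0 : ℝ) 1, t • z ∈ ball n := fun t ht =>
    smul_mem_ball hz (y := (t : ℂ)) (by simpa using ht.1.ne') (by
      simpa [abs_of_pos ht.1] using
        (mul_le_of_le_one_left (norm_nonneg z) ht.2).trans_lt hz.2.2)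
  have hle : metricDist n u (x • z) (y • z) ≤
      curveLength n u (fun t : ℝ => (x + t * (y - x)) • z) :=
    iInf₂_le_of_le _ (by fun_prop) <| iInf₂_le_of_le (fun t ht => hball _ (hmem t ht))
      (by simp) <| iInf_le_of_le (by simp) le_rfl
  refine hle.trans ?_
  have h : curveLength n u (fun t : ℝ => (x + t * (y - x)) • z) ≤
      ∫⁻ _ in Set.Ioo (0 : ℝ) 1, ENNReal.ofReal (|y - x| * C) := by
    refine setLIntegral_mono' measurableSet_Ioo fun t ht => ?_
    have hd : deriv (fun t : ℝ => (x + t * (y - x)) • z) t = (y - x) • z := by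
      have := ((((hasDerivAt_id t).mul_const (y - x)).const_add x).smul_const z).deriv
      simpa using this
    rw [hd]
    exact hC _ (hmem t ⟨ht.1.le, ht.2.le⟩) _
  refine h.trans ?_
  simp

lemma incompleteAtOrigin_of_radial_bound {u : EuclideanSpace ℂ (Fin (n + 1)) → ℝ}
    (hu : IsAdmissible n u) {z : EuclideanSpace ℂ (Fin (n + 1))} (hz : z ∈ ball n) {C : ℝ}
    (hC : ∀ t ∈ Set.Ioc (0 : ℝ) 1, ∀ s : ℝ,
      metricNorm n u (t • z) (s • z) ≤ ENNReal.ofReal (|s| * C)) :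
    IncompleteAtOrigin n u := by
  set x : ℕ → ℝ := fun k => 1 / ((k : ℝ) + 1) with hx
  have hxmem : ∀ k, x k ∈ Set.Ioc (0 : ℝ) 1 := fun k =>
    ⟨by positivity, by rw [hx, div_le_one (by positivity)]; simp⟩
  have hx0 : Tendsto x atTop (𝓝 0) := tendsto_one_div_add_atTop_nhds_zero_nat
  have hp0 : Tendsto (fun k => x k • z) atTop (𝓝 0) := by simpa using hx0.smul_const z
  refine ⟨fun k => x k • z, fun k => ?_, hp0, fun ε hε => ?_, fun q hq hlim => ?_⟩
  · exact smul_mem_ball hz (y := (x k : ℂ)) (by simpa using (hxmem k).1.ne') (by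
      simpa [abs_of_pos (hxmem k).1] using
        (mul_le_of_le_one_left (norm_nonneg z) (hxmem k).2).trans_lt hz.2.2)
  · have hlim : Tendsto (fun p : ℕ × ℕ => ENNReal.ofReal (|x p.2 - x p.1| * C)) atTop (𝓝 0) := by
      rw [← prod_atTop_atTop_eq]
      have h1 : Tendsto (fun p : ℕ × ℕ => |x p.2 - x p.1| * C) (atTop ×ˢ atTop) (𝓝 0) := by
        have h2 : Tendsto (fun p : ℕ × ℕ => x p.2 - x p.1) (atTop ×ˢ atTop) (𝓝 (0 - 0)) :=
          (hx0.comp tendsto_snd).sub (hx0.comp tendsto_fst)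
        simpa using h2.abs.mul_const C
      have h3 := (ENNReal.continuous_ofReal.tendsto 0).comp h1
      rwa [ENNReal.ofReal_zero] at h3
    obtain ⟨⟨N₁, N₂⟩, hN⟩ := eventually_atTop.1 (hlim.eventually (gt_mem_nhds hε))
    refine ⟨max N₁ N₂, fun k hk l hl => ?_⟩
    exact (metricDist_radial_le hz hC (hxmem k) (hxmem l)).trans_lt
      (hN (k, l) ⟨(le_max_left _ _).trans hk, (le_max_right _ _).trans hl⟩)
  · obtain ⟨δ, hδ, hev⟩ := exists_pos_le_metricDist hu hq
    obtain ⟨k, h1, h2⟩ := ((hp0.eventually hev).and (hlim.eventually (gt_mem_nhds hδ))).exists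
    exact (lt_of_le_of_lt h1 h2).false

lemma nonempty_ball (hn : 1 ≤ n) : (ball n).Nonempty := by
  obtain ⟨m, rfl⟩ := Nat.exists_eq_add_of_le' hn
  -- The isotropic vector (1, i, 0, …, 0), rescaled below to norm 1/2.
  set z₀ : EuclideanSpace ℂ (Fin (m + 1 + 1)) :=
    EuclideanSpace.single 0 1 + EuclideanSpace.single 1 Complex.I with hz₀
  have h1 : ∑ j, z₀ j * z₀ j = 0 := by
    rw [Fin.sum_univ_succ, Fin.sum_univ_succ, Finset.sum_eq_zero]
    · simp [hz₀]
    · intro i _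
      simp [hz₀, Fin.ext_iff]
  have h2 : z₀ ≠ 0 := fun h => by
    have : z₀ 0 = 0 := by rw [h]; rfl
    simp [hz₀] at this
  have h3 : 0 < ‖z₀‖ := norm_pos_iff.2 h2
  have hr : ((2 * ‖z₀‖ : ℝ) : ℂ)⁻¹ ≠ 0 := by
    simpa using h2
  refine ⟨((2 * ‖z₀‖ : ℝ) : ℂ)⁻¹ • z₀, ?_, smul_ne_zero hr h2, ?_⟩
  · have : ∀ j, (((2 * ‖z₀‖ : ℝ) : ℂ)⁻¹ • z₀) j * (((2 * ‖z₀‖ : ℝ) : ℂ)⁻¹ • z₀) j =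
        (((2 * ‖z₀‖ : ℝ) : ℂ)⁻¹) ^ 2 * (z₀ j * z₀ j) := fun j => by
      simp only [PiLp.smul_apply, smul_eq_mul]; ring
    simp_rw [this, ← Finset.mul_sum, h1, mul_zero]
  · rw [norm_smul, norm_inv, Complex.norm_real, Real.norm_of_nonneg (by positivity)]
    field_simp
    norm_num

end Kepler

end

theorem theorem7 (n : ℕ) (hn : 2 ≤ n)
    (u : EuclideanSpace ℂ (Fin (n + 1)) → ℝ) (hu : Kepler.IsAdmissible n u)
    (K : EuclideanSpace ℂ (Fin (n + 1)) → EuclideanSpace ℂ (Fin (n + 1)) → ℂ)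
    (hK : Kepler.IsBergmanKernel n u K)
    (c : ℝ) (hc : c ≠ 0)
    (hbal : ∀ z ∈ Kepler.ball n, K z z = ((c / u z ^ (n + 1) : ℝ) : ℂ)) :
    Kepler.IncompleteAtOrigin n u ∧
    (∀ z ∈ Kepler.ball n, Kepler.curveLength n u (fun x : ℝ => x • z) < ⊤) ∧
    (∀ z ∈ Kepler.ball n, ∃ (m : ℕ) (F : ℂ × ℂ → ℂ), AnalyticAt ℂ F (0, 0) ∧
      ∀ᶠ x : ℂ in 𝓝[≠] 0,
        K (x • z) (x • z) = ((‖x‖ ^ (2 * m) : ℝ) : ℂ) * Complex.exp (F (x, conj x))) := by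
  obtain ⟨κ, hκ⟩ := Kepler.exists_feature_map hK
  have hholo : ∀ x ∈ Kepler.ball n, Kepler.IsHolo n fun y => K y x := fun x hx => (hK.mem x hx).1
  have hnorm : ∀ z ∈ Kepler.ball n, ‖κ z‖ ^ 2 = c / u z ^ (n + 1) := fun z hz =>
    Kepler.norm_sq_feature_map hκ hbal hz
  have hbound : ∀ z ∈ Kepler.ball n, ∃ C : ℝ, ∀ t ∈ Set.Ioc (0 : ℝ) 1, ∀ s : ℝ,
      Kepler.metricNorm n u (t • z) (s • z) ≤ ENNReal.ofReal (|s| * C) := by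
    intro z hz
    obtain ⟨m, g, hg, hg0, heq⟩ :=
      Kepler.exists_feature_map_eq_pow_smul hn hu hholo hκ hc hbal hz
    exact Kepler.exists_bound_metricNorm_radial hu hz
      (Kepler.exists_bound_laplacian hu.pos hc hnorm hg hg0 heq)
  refine ⟨?_, fun z hz => ?_, fun z hz => ?_⟩
  · obtain ⟨z, hz⟩ := Kepler.nonempty_ball (one_le_two.trans hn)
    obtain ⟨C, hC⟩ := hbound z hz
    exact Kepler.incompleteAtOrigin_of_radial_bound hu hz hC
  · obtain ⟨C, hC⟩ := hbound z hz
    exact Kepler.curveLength_radial_lt_top hC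
  · obtain ⟨m, g, hg, hg0, heq⟩ :=
      Kepler.exists_feature_map_eq_pow_smul hn hu hholo hκ hc hbal hz
    obtain ⟨F, hF, hexp⟩ := Kepler.exists_analyticAt_exp_eq_norm_sq hg hg0
    refine ⟨m, F, hF, ?_⟩
    filter_upwards [heq, hexp.filter_mono nhdsWithin_le_nhds] with x hx hx'
    rw [hx', hbal _ hx.1, ← hnorm _ hx.1, hx.2]
    push_cast
    ring
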